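/- **Setting.** Let $N\ge 0$ and, for $i=1,\dots,N$, let $J_i\subseteq\mathbb R$ be an open set closed under decreasing its elements (an open half-line $(-\infty,a_i)$, the whole line, or empty). Let $f^i:J_i\to\mathbb C$ be nowhere vanishing functions of class $C^1$ and let $\sqrt{f^i}$ denote a continuous square root of $f^i$ on $J_i$. For a matrix function $F_{ij}(x,y)$, defined for $-x\in J_i$, $-y\in J_j$, with complex values, consider $$F_{ij}(s-u^i,s'-u^j)\qquad\text{and}\qquad \widetilde F_{ij}(s-u^i,s'-u^j)=\frac{\sqrt{f^j(u^j-s')}}{\sqrt{f^i(u^i-s)}}\,F_{ij}(s-u^i,s'-u^j)\qquad(u^i-s\in J_i,\ u^j-s'\in J_j)$$ as matrix functions $\mathcal F_{ij}(s,s',u)$. A matrix function $\mathcal F_{ij}(s,s',u)$ satisfies the *Zakharov differential relation* if, for all $i,j$ (equal or not), $$\frac{\partial \mathcal F_{ij}(s,s',u)}{\partial s'}+\frac{\partial \mathcal F_{ji}(s',s,u)}{\partial s}=0 .$$ **Part 1.** Assume that $F_{ij}(x,y)$ is of class $C^2$ and $F_{ij}(x,y)\sqrt{f^j(-y)}$ of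 class $C^1$, and that both decay at $+\infty$ in the following sense: on every closed quadrant $x\ge x_0$, $y\ge y_0$ contained in the domain, the derivatives of order $\le 2$ (respectively $\le 1$) are bounded by $m(x)b(y)$, where $m$ on $[x_0,\infty)$ and $b$ on $[y_0,\infty)$ are nonincreasing and integrable. Assume that both $F_{ij}(s-u^i,s'-u^j)$ and $\widetilde F_{ij}(s-u^i,s'-u^j)$ satisfy the Zakharov differential relation. Let $W\subseteq\mathbb R\times\mathbb R^N$ be an open set such that $u^i-s\in J_i$ for all $i$ and all $(s,u)\in W$, and suppose that for each $(s,u)\in W$ the matrix function $s'\mapsto K_{ij}(s,s',u)$, $s'\ge s$, is the unique bounded continuous solution on $[s,\infty)$ of the linear integral equation $$K_{ij}(s,s',u)=F_{ij}(s-u^i,s'-u^j)+\int_s^\infty\sum_l K_{il}(s,q,u)\,F_{lj}(q-u^l,s'-u^j)\,dq .$$ Put $\beta_{ij}(s,u)=K_{ji}(s,s,u)$. Then, at every $(s,u)\in W$, the functions $\beta_{ij}(s,\cdot)$ are differentiable in $u$ and satisfy $$\frac{\partial\beta_{ij}}{\partial u^k}=\beta_{ik}\beta_{kj}\qquad (i\ne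 j,\ i\ne k,\ j\ne k),$$ $$\frac{\partial\beta_{ij}}{\partial u^i}+\frac{\partial\beta_{ji}}{\partial u^j}+\sum_{l\ne i,\,l\ne j}\beta_{li}\beta_{lj}=0\qquad(i\ne j),$$ $$\sqrt{f^i_s(u^i)}\,\frac{\partial\bigl(\sqrt{f^i_s(u^i)}\,\beta_{ij}\bigr)}{\partial u^i}+\sqrt{f^j_s(u^j)}\,\frac{\partial\bigl(\sqrt{f^j_s(u^j)}\,\beta_{ji}\bigr)}{\partial u^j}+\sum_{l\ne i,\,l\ne j}f^l_s(u^l)\,\beta_{li}\beta_{lj}=0\qquad(i\ne j),$$ where $f^i_s(x)=f^i(x-s)$ and $\sqrt{f^i_s(x)}=\sqrt{f^i}(x-s)$. In particular, for $s=0$ this is the system with the functions $f^i(u^i)$ themselves. **Part 2.** Let $\Phi_{ij}(x,y)$, $i\le j$, be functions of class $C^2$ on $-x\in J_i$, $-y\in J_j$, with $\Phi_{ii}(x,y)=-\Phi_{ii}(y,x)$, and let $F$ be a matrix function generated by them: $$F_{ij}(s-u^i,s'-u^j)=\frac{\partial\Phi_{ij}(s-u^i,s'-u^j)}{\partial s}\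 (i\le j),\qquad F_{ji}(s-u^j,s'-u^i)=-\frac{\partial\Phi_{ij}(s'-u^i,s-u^j)}{\partial s}\ (i<j).$$ Then $F_{ij}(s-u^i,s'-u^j)$ satisfies the Zakharov differential relation, and $\widetilde F_{ij}(s-u^i,s'-u^j)$ satisfies it if and only if the linear equations $$2\frac{\partial^2\Phi_{ij}}{\partial u^i\partial u^j}\bigl(f^i(u^i-s)-f^j(u^j-s')\bigr)+\frac{\partial\Phi_{ij}}{\partial u^j}\frac{d f^i(u^i-s)}{du^i}-\frac{\partial\Phi_{ij}}{\partial u^i}\frac{d f^j(u^j-s')}{du^j}=0\quad(i<j),\qquad \Phi_{ij}=\Phi_{ij}(s-u^i,s'-u^j),$$ $$2\frac{\partial^2\Phi_{ii}}{\partial s\,\partial s'}\bigl(f^i(u^i-s)-f^i(u^i-s')\bigr)-\frac{\partial\Phi_{ii}}{\partial s}\frac{d f^i(u^i-s')}{ds'}+\frac{\partial\Phi_{ii}}{\partial s'}\frac{d f^i(u^i-s)}{ds}=0,\qquad \Phi_{ii}=\Phi_{ii}(s-u^i,s'-u^i),$$ hold for all $u,s,s'$ with $u^i-s\in J_i$,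 $u^j-s'\in J_j$ (with $j=i$ in the second equation). -/

import Mathlib

open Set MeasureTheory

noncomputable section

/-- The partial derivative `∂φ/∂uᵏ` at the point `u`. -/
def pd {N : ℕ} (k : Fin N) (φ : (Fin N → ℝ) → ℂ) (u : Fin N → ℝ) : ℂ :=
  deriv (fun t : ℝ => φ (Function.update u k t)) (u k)

/-- First part of the Lamé equations at the point `u`:
`∂β_ij/∂uᵏ = β_ik β_kj` for pairwise distinct `i, j, k`. -/
def Lame1 {N : ℕ} (β : Fin N → Fin N → (Fin N → ℝ) → ℂ) (u : Fin N → ℝ) : Prop :=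
  ∀ i j k : Fin N, i ≠ j → i ≠ k → j ≠ k → pd k (β i j) u = β i k u * β k j u

/-- Second part of the Lamé equations at the point `u`:
`∂β_ij/∂uⁱ + ∂β_ji/∂uʲ + ∑_{l ≠ i, j} β_li β_lj = 0` for `i ≠ j`. -/
def Lame2 {N : ℕ} (β : Fin N → Fin N → (Fin N → ℝ) → ℂ) (u : Fin N → ℝ) : Prop :=
  ∀ i j : Fin N, i ≠ j →
    pd i (β i j) u + pd j (β j i) u
      + ∑ l : Fin N with l ≠ i ∧ l ≠ j, β l i u * β l j u = 0

/-- The additional reduction of the Lamé equations attached to functions `fⁱ` of one variable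
with square roots `rⁱ = √fⁱ`, at the point `u`:
`√fⁱ ∂(√fⁱ β_ij)/∂uⁱ + √fʲ ∂(√fʲ β_ji)/∂uʲ + ∑_{l ≠ i, j} fˡ β_li β_lj = 0` for `i ≠ j`,
with `fⁱ = fⁱ(uⁱ)`. -/
def Lame3 {N : ℕ} (f r : Fin N → ℝ → ℂ) (β : Fin N → Fin N → (Fin N → ℝ) → ℂ)
    (u : Fin N → ℝ) : Prop :=
  ∀ i j : Fin N, i ≠ j →
    r i (u i) * pd i (fun w => r i (w i) * β i j w) u
      + r j (u j) * pd j (fun w => r j (w j) * β j i w) u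
      + ∑ l : Fin N with l ≠ i ∧ l ≠ j, f l (u l) * β l i u * β l j u = 0

/-- The dressing matrix function `F_ij(s - uⁱ, s' - uʲ)`. -/
def dressing {N : ℕ} (F : Fin N → Fin N → ℝ → ℝ → ℂ)
    (i j : Fin N) (s s' : ℝ) (u : Fin N → ℝ) : ℂ :=
  F i j (s - u i) (s' - u j)

/-- The rescaled dressing matrix function
`(√fʲ(uʲ - s') / √fⁱ(uⁱ - s)) F_ij(s - uⁱ, s' - uʲ)`, where `rⁱ = √fⁱ`. -/
def rescaledDressing {N : ℕ} (r : Fin N → ℝ → ℂ) (F : Fin N → Fin N → ℝ → ℝ → ℂ)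
    (i j : Fin N) (s s' : ℝ) (u : Fin N → ℝ) : ℂ :=
  r j (u j - s') / r i (u i - s) * F i j (s - u i) (s' - u j)

/-- The Zakharov differential relation
`∂𝓕_ij(s, s', u)/∂s' + ∂𝓕_ji(s', s, u)/∂s = 0` for all `i, j` (equal or not), on the region
`uⁱ - s ∈ Jⁱ`, `uʲ - s' ∈ Jʲ`. -/
def ZakharovRelation {N : ℕ} (J : Fin N → Set ℝ)
    (𝓕 : Fin N → Fin N → ℝ → ℝ → (Fin N → ℝ) → ℂ) : Prop :=
  ∀ (i j : Fin N) (u : Fin N → ℝ) (s s' : ℝ), u i - s ∈ J i → u j - s' ∈ J j →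
    deriv (fun t : ℝ => 𝓕 i j s t u) s' + deriv (fun t : ℝ => 𝓕 j i s' t u) s = 0

/-- The region `-x ∈ A`, `-y ∈ B` of the plane. -/
def quadrant (A B : Set ℝ) : Set (ℝ × ℝ) := {p | -p.1 ∈ A ∧ -p.2 ∈ B}

/-- `H` is of class `Cⁿ` on the region `-x ∈ A`, `-y ∈ B`, and on every closed quadrant
`x ≥ x₀`, `y ≥ y₀` of that region its derivatives of order at most `n` are bounded by
`m(x) b(y)` with `m`, `b` nonincreasing and integrable. -/
def Decays (n : ℕ) (A B : Set ℝ) (H : ℝ × ℝ → ℂ) : Prop :=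
  ContDiffOn ℝ n H (quadrant A B) ∧
  ∀ x₀ y₀ : ℝ, -x₀ ∈ A → -y₀ ∈ B →
    ∃ m b : ℝ → ℝ, AntitoneOn m (Ici x₀) ∧ IntegrableOn m (Ici x₀) ∧
      AntitoneOn b (Ici y₀) ∧ IntegrableOn b (Ici y₀) ∧
      ∀ k ≤ n, ∀ x ≥ x₀, ∀ y ≥ y₀, ‖iteratedFDeriv ℝ k H (x, y)‖ ≤ m x * b y

/-- For a fixed value of `u` (hidden in the kernel `𝓕`) and of `s`: the matrix function
`k_ij(s') = K_ij(s, s', u)`, `s' ≥ s`, is a bounded continuous solution of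
`K_ij(s, s') = 𝓕_ij(s, s') + ∫_s^∞ ∑_l K_il(s, q) 𝓕_lj(q, s') dq`. -/
structure IsGLMSolution {N : ℕ} (𝓕 : Fin N → Fin N → ℝ → ℝ → ℂ) (s : ℝ)
    (k : Fin N → Fin N → ℝ → ℂ) : Prop where
  continuousOn : ∀ i j, ContinuousOn (k i j) (Ici s)
  bounded : ∃ C : ℝ, ∀ i j, ∀ s' ≥ s, ‖k i j s'‖ ≤ C
  equation : ∀ i j, ∀ s' ≥ s,
    k i j s' = 𝓕 i j s s' + ∫ q in Ioi s, ∑ l : Fin N, k i l q * 𝓕 l j q s'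

/-- `k` is the unique bounded continuous solution on `[s, ∞)`. -/
def IsUniqueGLMSolution {N : ℕ} (𝓕 : Fin N → Fin N → ℝ → ℝ → ℂ) (s : ℝ)
    (k : Fin N → Fin N → ℝ → ℂ) : Prop :=
  IsGLMSolution 𝓕 s k ∧
  ∀ k' : Fin N → Fin N → ℝ → ℂ, IsGLMSolution 𝓕 s k' →
    ∀ i j, ∀ s' ≥ s, k' i j s' = k i j s'

/-- `β_ij(s, u) = K_ji(s, s, u)`. -/
def rotationCoeff {N : ℕ} (K : Fin N → Fin N → ℝ → ℝ → (Fin N → ℝ) → ℂ) (s : ℝ)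
    (i j : Fin N) (u : Fin N → ℝ) : ℂ :=
  K j i s s u

/-- The functions `Φ_ij`, `i ≤ j`, of class `C²`, with `Φ_ii` skew-symmetric, generate `F`:
`F_ij(s - uⁱ, s' - uʲ) = ∂Φ_ij(s - uⁱ, s' - uʲ)/∂s` for `i ≤ j` and
`F_ji(s - uʲ, s' - uⁱ) = -∂Φ_ij(s' - uⁱ, s - uʲ)/∂s` for `i < j`.
The values of `Φ_ij` for `i > j` play no role. -/
structure Generates {N : ℕ} (J : Fin N → Set ℝ) (Φ F : Fin N → Fin N → ℝ → ℝ → ℂ) : Prop where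
  smooth : ∀ i j, i ≤ j →
    ContDiffOn ℝ 2 (fun p : ℝ × ℝ => Φ i j p.1 p.2) (quadrant (J i) (J j))
  skew : ∀ i, ∀ x y : ℝ, -x ∈ J i → -y ∈ J i → Φ i i x y = - Φ i i y x
  upper : ∀ i j, i ≤ j → ∀ (u : Fin N → ℝ) (s s' : ℝ), u i - s ∈ J i → u j - s' ∈ J j →
    F i j (s - u i) (s' - u j) = deriv (fun t : ℝ => Φ i j (t - u i) (s' - u j)) s
  lower : ∀ i j, i < j → ∀ (u : Fin N → ℝ) (s s' : ℝ), u j - s ∈ J j → u i - s' ∈ J i →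
    F j i (s - u j) (s' - u i) = - deriv (fun t : ℝ => Φ i j (s' - u i) (t - u j)) s

/-- The linear equations for the off-diagonal generating functions, `i < j`:
`2 ∂²Φ_ij/∂uⁱ∂uʲ (fⁱ(uⁱ - s) - fʲ(uʲ - s')) + ∂Φ_ij/∂uʲ dfⁱ(uⁱ - s)/duⁱ
  - ∂Φ_ij/∂uⁱ dfʲ(uʲ - s')/duʲ = 0`, with `Φ_ij = Φ_ij(s - uⁱ, s' - uʲ)`. -/
def LinearOffDiag {N : ℕ} (J : Fin N → Set ℝ) (f : Fin N → ℝ → ℂ)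
    (Φ : Fin N → Fin N → ℝ → ℝ → ℂ) : Prop :=
  ∀ i j : Fin N, i < j → ∀ (u : Fin N → ℝ) (s s' : ℝ), u i - s ∈ J i → u j - s' ∈ J j →
    2 * pd i (pd j (fun w => Φ i j (s - w i) (s' - w j))) u
        * (f i (u i - s) - f j (u j - s'))
      + pd j (fun w => Φ i j (s - w i) (s' - w j)) u * deriv (fun t : ℝ => f i (t - s)) (u i)
      - pd i (fun w => Φ i j (s - w i) (s' - w j)) u * deriv (fun t : ℝ => f j (t - s')) (u j)
      = 0

/-- The linear equations for the diagonal generating functions: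
`2 ∂²Φ_ii/∂s∂s' (fⁱ(uⁱ - s) - fⁱ(uⁱ - s')) - ∂Φ_ii/∂s dfⁱ(uⁱ - s')/ds'
  + ∂Φ_ii/∂s' dfⁱ(uⁱ - s)/ds = 0`, with `Φ_ii = Φ_ii(s - uⁱ, s' - uⁱ)`. -/
def LinearDiag {N : ℕ} (J : Fin N → Set ℝ) (f : Fin N → ℝ → ℂ)
    (Φ : Fin N → Fin N → ℝ → ℝ → ℂ) : Prop :=
  ∀ (i : Fin N) (u : Fin N → ℝ) (s s' : ℝ), u i - s ∈ J i → u i - s' ∈ J i →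
    2 * deriv (fun x : ℝ => deriv (fun y : ℝ => Φ i i (x - u i) (y - u i)) s') s
        * (f i (u i - s) - f i (u i - s'))
      - deriv (fun x : ℝ => Φ i i (x - u i) (s' - u i)) s
        * deriv (fun y : ℝ => f i (u i - y)) s'
      + deriv (fun y : ℝ => Φ i i (s - u i) (y - u i)) s'
        * deriv (fun x : ℝ => f i (u i - x)) s
      = 0

end

/-! Part 1. For fixed (s, u), the i-th row of K solves k_i = g_i + A k_i in the Banach space of
bounded continuous rows, where g_i is a row of F and A is the integral operator with kernel F. Since
the kernel is integrable in its first variable, A is a norm limit of finite-rank operators, hence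
compact. Uniqueness of K says that 1 - A is injective, so by the Fredholm alternative it is
invertible. Taylor's formula with a decaying remainder makes g_i and A differentiable in u, so K is
differentiable in u as well.

Differentiate the equation in u^m, with m ≠ i. The first argument of F contributes ∫ K_im ∂₁F_mj.
The second argument contributes a row L supported in column m, whose entry there is ∂K_im/∂s'.
Integration by parts in q turns the first contribution into -K_im(s) g_m minus A L. Hence ∂K_i/∂u^m
+ L - K_im(s) K_m solves the homogeneous equation and vanishes (`DecayingKernel.fderiv_row_apply`).
Off column m this is the first Lamé system; it needs no Zakharov relation. In column m it reads
∂K_im/∂u^m = K_im K_mm - ∂K_im/∂s' at s' = s.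

For the quadratic relations put ρ_j(q) = √f^j(u^j - q). The Zakharov relation for the rescaled
kernel says that ρ_j(q) ∂_q(F_lj ρ_j) is skew under exchange of indices and arguments. Let T_i
denote the s'-derivative of the weighted row K_i ρ. Pairing T_i with K_j ρ and adding the transposed
expression gives zero by Fubini. Integrating the exact derivative of ∑ K_il ρ_l K_jl ρ_l leaves a
boundary term, so T_ij ρ_j + T_ji ρ_i = ∑_l ρ_l² K_il K_jl at s
(`DecayingKernel.rowTransform_dSnd_add`). The terms l = i, j combine with K_im K_mm above, which is
the third relation; the second is the case of weight 1.

Part 2. Here F_ij = ∂₁Φ_ij and F_ji with exchanged arguments is -∂₂Φ_ij, also on the diagonal by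
skew symmetry. The unweighted relation is equality of mixed derivatives. The weighted one,
multiplied by -2√f^i√f^j, is the linear equation for Φ_ij. -/

noncomputable section

open Filter Topology

/-- Bounded continuous row vectors on the line. -/
abbrev RowSpace (N : ℕ) := BoundedContinuousFunction ℝ (Fin N → ℂ)

/-! ### Integral operators with L¹ densities and their compactness -/

section RowIntegral

variable {N : ℕ} {X : Type*} [NormedAddCommGroup X] [NormedSpace ℂ X]

theorem norm_row_entry_le (k : RowSpace N) (q : ℝ) (l : Fin N) : ‖k q l‖ ≤ ‖k‖ :=
  (norm_le_pi_norm (k q) l).trans (k.norm_coe_le_norm q)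

theorem continuous_row_entry (k : RowSpace N) (l : Fin N) : Continuous fun q => k q l :=
  (continuous_apply l).comp k.continuous

theorem MeasureTheory.IntegrableOn.row_smul {s : ℝ} {φ : ℝ → X}
    (hφ : IntegrableOn φ (Ioi s)) (k : RowSpace N) (l : Fin N) :
    IntegrableOn (fun q => k q l • φ q) (Ioi s) := by
  refine Integrable.mono' (hφ.norm.const_mul ‖k‖)
    ((continuous_row_entry k l).aestronglyMeasurable.smul hφ.aestronglyMeasurable) ?_
  refine Eventually.of_forall fun q => ?_
  rw [norm_smul]
  exact mul_le_mul_of_nonneg_right (norm_row_entry_le k q l) (norm_nonneg _)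

theorem norm_integral_row_smul_le {s : ℝ} {φ : ℝ → X}
    (hφ : IntegrableOn φ (Ioi s)) (k : RowSpace N) (l : Fin N) :
    ‖∫ q in Ioi s, k q l • φ q‖ ≤ (∫ q in Ioi s, ‖φ q‖) * ‖k‖ := by
  rw [mul_comm, ← integral_const_mul]
  refine norm_integral_le_of_norm_le (hφ.norm.const_mul ‖k‖) (Eventually.of_forall fun q => ?_)
  rw [norm_smul]
  exact mul_le_mul_of_nonneg_right (norm_row_entry_le k q l) (norm_nonneg _)

open Classical in
/-- The operator `k ↦ ∫_s^∞ k_l(q) φ(q) dq`, for integrable `φ`. -/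
def rowIntegral (N : ℕ) (s : ℝ) (l : Fin N) (φ : ℝ → X) : RowSpace N →L[ℝ] X :=
  if hφ : IntegrableOn φ (Ioi s) then
    LinearMap.mkContinuous
      { toFun := fun k => ∫ q in Ioi s, k q l • φ q
        map_add' := fun k k' => by
          rw [← integral_add (hφ.row_smul k l) (hφ.row_smul k' l)]
          simp only [BoundedContinuousFunction.add_apply, Pi.add_apply, add_smul]
        map_smul' := fun c k => by
          rw [RingHom.id_apply, ← integral_smul]
          simp only [BoundedContinuousFunction.smul_apply, Pi.smul_apply, smul_assoc] }
      (∫ q in Ioi s, ‖φ q‖) (fun k => norm_integral_row_smul_le hφ k l)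
  else 0

theorem rowIntegral_apply {s : ℝ} (l : Fin N) {φ : ℝ → X} (hφ : IntegrableOn φ (Ioi s))
    (k : RowSpace N) : rowIntegral N s l φ k = ∫ q in Ioi s, k q l • φ q := by
  rw [rowIntegral, dif_pos hφ]; rfl

theorem norm_rowIntegral_le {s : ℝ} (l : Fin N) {φ : ℝ → X} (hφ : IntegrableOn φ (Ioi s)) :
    ‖rowIntegral N s l φ‖ ≤ ∫ q in Ioi s, ‖φ q‖ := by
  refine ContinuousLinearMap.opNorm_le_bound _ (integral_nonneg fun _ => norm_nonneg _) fun k => ?_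
  rw [rowIntegral_apply l hφ]
  exact norm_integral_row_smul_le hφ k l

theorem rowIntegral_add {s : ℝ} (l : Fin N) {φ ψ : ℝ → X} (hφ : IntegrableOn φ (Ioi s))
    (hψ : IntegrableOn ψ (Ioi s)) :
    rowIntegral N s l (fun q => φ q + ψ q) = rowIntegral N s l φ + rowIntegral N s l ψ := by
  ext1 k
  rw [add_apply, rowIntegral_apply (φ := fun q => φ q + ψ q) l (hφ.add hψ),
    rowIntegral_apply l hφ,
    rowIntegral_apply l hψ, ← integral_add (hφ.row_smul k l) (hψ.row_smul k l)]
  simp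

theorem rowIntegral_smul {s : ℝ} (l : Fin N) {φ : ℝ → X} (hφ : IntegrableOn φ (Ioi s)) (c : ℝ) :
    rowIntegral N s l (fun q => c • φ q) = c • rowIntegral N s l φ := by
  ext1 k
  rw [smul_apply, rowIntegral_apply (φ := fun q => c • φ q) l (hφ.smul c),
    rowIntegral_apply l hφ,
    ← integral_smul]
  simp only [smul_comm _ c]

theorem rowIntegral_sub {s : ℝ} (l : Fin N) {φ ψ : ℝ → X} (hφ : IntegrableOn φ (Ioi s))
    (hψ : IntegrableOn ψ (Ioi s)) :
    rowIntegral N s l (fun q => φ q - ψ q) = rowIntegral N s l φ - rowIntegral N s l ψ := by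
  ext1 k
  rw [sub_apply, rowIntegral_apply (φ := fun q => φ q - ψ q) l (hφ.sub hψ),
    rowIntegral_apply l hφ,
    rowIntegral_apply l hψ, ← integral_sub (hφ.row_smul k l) (hψ.row_smul k l)]
  simp [smul_sub]

theorem rowIntegral_sum {ι : Type*} {s : ℝ} (l : Fin N) (t : Finset ι) {φ : ι → ℝ → X}
    (hφ : ∀ a ∈ t, IntegrableOn (φ a) (Ioi s)) :
    rowIntegral N s l (fun q => ∑ a ∈ t, φ a q) = ∑ a ∈ t, rowIntegral N s l (φ a) := by
  ext1 k
  rw [sum_apply, rowIntegral_apply l (integrable_finsetSum t hφ),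
    Finset.sum_congr rfl fun a ha => rowIntegral_apply l (hφ a ha) k,
    ← integral_finsetSum t fun a ha => (hφ a ha).row_smul k l]
  simp [Finset.smul_sum]

theorem rowIntegral_congr_ae {s : ℝ} (l : Fin N) {φ ψ : ℝ → X}
    (h : φ =ᵐ[volume.restrict (Ioi s)] ψ) : rowIntegral N s l φ = rowIntegral N s l ψ := by
  by_cases hφ : IntegrableOn φ (Ioi s)
  · have hψ : IntegrableOn ψ (Ioi s) := Integrable.congr hφ h
    ext1 k
    rw [rowIntegral_apply l hφ, rowIntegral_apply l hψ]
    exact integral_congr_ae (h.mono fun q hq => by simp only [hq])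
  · have hψ : ¬ IntegrableOn ψ (Ioi s) := fun h' => hφ (Integrable.congr h' h.symm)
    rw [rowIntegral, rowIntegral, dif_neg hφ, dif_neg hψ]

/-- Simple densities give finite-rank operators, these densities are dense in L¹, and the operator
norm is at most the L¹ norm of the density. Norm limits of compact operators are compact. -/
theorem rowIntegral_isCompactOperator [CompleteSpace X] {s : ℝ} (l : Fin N) {φ : ℝ → X}
    (hφ : IntegrableOn φ (Ioi s)) : IsCompactOperator (rowIntegral N s l φ) := by
  refine Integrable.induction (μ := volume.restrict (Ioi s))
    (fun φ => IsCompactOperator (rowIntegral N s l φ)) ?_ ?_ ?_ ?_ hφ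
  · intro c S hS hfin
    have h1 : IntegrableOn (S.indicator fun _ => (1 : ℂ)) (Ioi s) :=
      (integrable_indicator_iff hS).2 (integrableOn_const hfin.ne)
    have hc : IntegrableOn (S.indicator fun _ => c) (Ioi s) :=
      (integrable_indicator_iff hS).2 (integrableOn_const hfin.ne)
    have hcomp : rowIntegral N s l (S.indicator fun _ => c)
        -- For a density equal to c times an indicator, the operator factors through a scalar
        -- functional with values in ℂ.
        = (((1 : ℂ →L[ℂ] ℂ).smulRight c).restrictScalars ℝ).comp
            (rowIntegral N s l (S.indicator fun _ => (1 : ℂ))) := by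
      ext1 k
      rw [rowIntegral_apply l hc, ContinuousLinearMap.comp_apply, rowIntegral_apply l h1,
        ← ContinuousLinearMap.integral_comp_comm _ (h1.row_smul k l)]
      refine integral_congr_ae (Eventually.of_forall fun q => ?_)
      by_cases hq : q ∈ S <;> simp [hq]
    rw [hcomp]
    exact (isCompactOperator_of_locallyCompactSpace_dom
      (rowIntegral N s l (S.indicator fun _ => (1 : ℂ)))).clm_comp
        (((1 : ℂ →L[ℂ] ℂ).smulRight c).restrictScalars ℝ)
  · intro φ ψ _ hφ hψ hcφ hcψ
    have := rowIntegral_add l hφ hψ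
    change IsCompactOperator (rowIntegral N s l (fun q => φ q + ψ q))
    rw [this]
    exact hcφ.add hcψ
  · have hcont : Continuous fun φ : ℝ →₁[volume.restrict (Ioi s)] X => rowIntegral N s l φ := by
      have hL : LipschitzWith 1
          fun φ : ℝ →₁[volume.restrict (Ioi s)] X => rowIntegral N s l φ := ?_
      · exact hL.continuous
      refine LipschitzWith.of_dist_le_mul fun φ ψ => ?_
      rw [dist_eq_norm, dist_eq_norm,
        ← rowIntegral_sub l (L1.integrable_coeFn φ) (L1.integrable_coeFn ψ), NNReal.coe_one,
        one_mul, L1.norm_eq_integral_norm]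
      refine (norm_rowIntegral_le l
        ((L1.integrable_coeFn φ).sub (L1.integrable_coeFn ψ))).trans_eq ?_
      refine integral_congr_ae ((Lp.coeFn_sub φ ψ).mono fun q hq => ?_)
      exact congrArg norm hq.symm
    exact isClosed_setOfPred_isCompactOperator.preimage hcont
  · intro φ ψ h _ hc
    rwa [← rowIntegral_congr_ae l h]

end RowIntegral

/-! ### Fredholm equations k = g + A k depending on a parameter -/

section LinearEquation

variable {U X : Type*} [NormedAddCommGroup U] [NormedSpace ℝ U]
  [NormedAddCommGroup X] [NormedSpace ℝ X] [CompleteSpace X]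

/-- The Fredholm alternative at the spectral value 1: failure of invertibility would produce an
eigenvector. -/
theorem IsCompactOperator.isUnit_one_sub {T : X →L[ℝ] X} (hT : IsCompactOperator T)
    (hinj : ∀ k, k = T k → k = 0) : IsUnit (1 - T) := by
  rcases hT.hasEigenvalue_or_mem_resolventSet (one_ne_zero (α := ℝ)) with h | h
  · obtain ⟨k, hk⟩ := h.exists_hasEigenvector
    exact absurd (hinj k (by simpa using hk.apply_eq_smul.symm)) hk.2
  · simpa [spectrum.mem_resolventSet_iff] using h

/-- Units are open, so near u the equation forces k = (1 - A)⁻¹ g, and inversion is differentiable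
at a unit. No continuity of k has to be assumed, and uniqueness is needed only at u. -/
theorem differentiableAt_of_eq_add_clm_apply {A : U → X →L[ℝ] X} {g k : U → X} {u : U}
    (hA : DifferentiableAt ℝ A u) (hg : DifferentiableAt ℝ g u) (hu : IsUnit (1 - A u))
    (hk : ∀ᶠ v in 𝓝 u, k v = g v + A v (k v)) : DifferentiableAt ℝ k u := by
  have h1 : DifferentiableAt ℝ (fun v => Ring.inverse (1 - A v)) u := by
    obtain ⟨a, ha⟩ := hu
    have := differentiableAt_inverse (𝕜 := ℝ) (R := X →L[ℝ] X) a.isUnit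
    exact DifferentiableAt.comp (g := Ring.inverse) (f := fun v => 1 - A v) u (ha ▸ this)
      ((differentiableAt_const _).sub hA)
  refine (h1.clm_apply hg).congr_of_eventuallyEq ?_
  have hopen : ∀ᶠ v in 𝓝 u, IsUnit (1 - A v) :=
    (continuousAt_const.sub hA.continuousAt).eventually (Units.isOpen.mem_nhds hu)
  filter_upwards [hopen, hk] with v hv hkv
  have : g v = (1 - A v) (k v) := by
    rw [sub_apply, one_apply_eq_self, eq_sub_iff_add_eq]
    exact hkv.symm
  rw [this, ← mul_apply_eq_comp, Ring.inverse_mul_cancel _ hv,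
    one_apply_eq_self]

theorem fderiv_apply_of_eq_add_clm_apply {A : U → X →L[ℝ] X} {g k : U → X} {u : U}
    {A' : U →L[ℝ] X →L[ℝ] X} {g' : U →L[ℝ] X}
    (hA : HasFDerivAt A A' u) (hg : HasFDerivAt g g' u) (hu : IsUnit (1 - A u))
    (hk : ∀ᶠ v in 𝓝 u, k v = g v + A v (k v)) (h : U) :
    fderiv ℝ k u h = g' h + A' h (k u) + A u (fderiv ℝ k u h) := by
  have hd := (differentiableAt_of_eq_add_clm_apply hA.differentiableAt hg.differentiableAt
    hu hk).hasFDerivAt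
  have h2 := (hg.add (hA.clm_apply hd)).congr_of_eventuallyEq hk
  have h3 := congrArg (fun T => T h) (hd.unique h2)
  refine h3.trans ?_
  simp
  abel

theorem hasFDerivAt_of_norm_sub_le_sq {Y : Type*} [NormedAddCommGroup Y] [NormedSpace ℝ Y]
    {f : U → Y} {f' : U →L[ℝ] Y} {C ε : ℝ} (hε : 0 < ε)
    (h : ∀ v, ‖v‖ < ε → ‖f v - f 0 - f' v‖ ≤ C * ‖v‖ ^ 2) : HasFDerivAt f f' 0 := by
  rw [hasFDerivAt_iff_isLittleO]
  have h1 : (fun v => f v - f 0 - f' (v - 0)) =O[𝓝 0] fun v : U => ‖v‖ ^ 2 := by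
    refine Asymptotics.IsBigO.of_bound C ?_
    filter_upwards [Metric.ball_mem_nhds (0 : U) hε] with v hv
    simpa using h v (by simpa using hv)
  refine h1.trans_isLittleO ?_
  simpa using Asymptotics.isLittleO_norm_pow_id (E' := U) (n := 2) one_lt_two

end LinearEquation

section Bounded

variable {X V : Type*} [TopologicalSpace X] [NormedAddCommGroup V]

open Classical in
/-- The bounded continuous function with the given values (`0` if there is none). -/
def toBounded (g : X → V) : BoundedContinuousFunction X V :=
  if h : Continuous g ∧ ∃ C, ∀ x, ‖g x‖ ≤ C then
    BoundedContinuousFunction.ofNormedAddCommGroup g h.1 h.2.choose h.2.choose_spec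
  else 0

theorem toBounded_apply {g : X → V} (hg : Continuous g) {C : ℝ} (hC : ∀ x, ‖g x‖ ≤ C) (x : X) :
    toBounded g x = g x := by
  rw [toBounded, dif_pos ⟨hg, C, hC⟩]; rfl

end Bounded

/-! ### Kernels dominated by a product M(x) B(y), and their integral operators -/

/-- `M` and `B` are nonnegative, nonincreasing and integrable on `[t, ∞)`. -/
structure DecayBounds (t : ℝ) (M B : ℝ → ℝ) : Prop where
  nonneg_left : ∀ x ≥ t, 0 ≤ M x
  nonneg_right : ∀ x ≥ t, 0 ≤ B x
  anti_left : AntitoneOn M (Ici t)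
  anti_right : AntitoneOn B (Ici t)
  integrable_left : IntegrableOn M (Ici t)
  integrable_right : IntegrableOn B (Ici t)

/-- A matrix kernel which is `Cⁿ` near the quadrant `x, y ≥ t`, with derivatives bounded
by `M(x) B(y)`. -/
structure DecayingKernel {N : ℕ} (n : ℕ) (t : ℝ) (H : Fin N → Fin N → ℝ × ℝ → ℂ)
    (M B : ℝ → ℝ) : Prop extends DecayBounds t M B where
  contDiffAt : ∀ i j, ∀ x ≥ t, ∀ y ≥ t, ContDiffAt ℝ n (H i j) (x, y)
  norm_iteratedFDeriv_le : ∀ i j, ∀ k ≤ n, ∀ x ≥ t, ∀ y ≥ t,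
    ‖iteratedFDeriv ℝ k (H i j) (x, y)‖ ≤ M x * B y

/-- A matrix kernel bounded by `M(x) B(y)` and Lipschitz on the quadrant `x, y ≥ t`. -/
structure TameKernel {N : ℕ} (t : ℝ) (H : Fin N → Fin N → ℝ × ℝ → ℂ)
    (M B : ℝ → ℝ) : Prop extends DecayBounds t M B where
  norm_le : ∀ i j, ∀ x ≥ t, ∀ y ≥ t, ‖H i j (x, y)‖ ≤ M x * B y
  lipschitz : ∀ i j, ∀ p ∈ Ici t ×ˢ Ici t, ∀ p' ∈ Ici t ×ˢ Ici t,
    ‖H i j p' - H i j p‖ ≤ M t * B t * ‖p' - p‖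

/-- The derivative of a kernel in its first argument. -/
def dFst {N : ℕ} (H : Fin N → Fin N → ℝ × ℝ → ℂ) (i j : Fin N) (p : ℝ × ℝ) : ℂ :=
  fderiv ℝ (H i j) p (1, 0)

/-- The derivative of a kernel in its second argument. -/
def dSnd {N : ℕ} (H : Fin N → Fin N → ℝ × ℝ → ℂ) (i j : Fin N) (p : ℝ × ℝ) : ℂ :=
  fderiv ℝ (H i j) p (0, 1)

/-- The matrix kernel with all columns but the `k`-th one replaced by zero. -/
def onlyColumn {N : ℕ} (k : Fin N) (H : Fin N → Fin N → ℝ × ℝ → ℂ) (i j : Fin N)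
    (p : ℝ × ℝ) : ℂ :=
  if j = k then H i j p else 0

section Kernel

variable {N : ℕ} {t : ℝ} {H : Fin N → Fin N → ℝ × ℝ → ℂ} {M B : ℝ → ℝ}

theorem DecayBounds.mul_le {t : ℝ} {M B : ℝ → ℝ} (h : DecayBounds t M B) {x x' y y' : ℝ}
    (hx : t ≤ x) (hxx' : x ≤ x') (hy : t ≤ y) (hyy' : y ≤ y') : M x' * B y' ≤ M x * B y :=
  mul_le_mul (h.anti_left hx (hx.trans hxx') hxx') (h.anti_right hy (hy.trans hyy') hyy')
    (h.nonneg_right _ (hy.trans hyy')) (h.nonneg_left _ hx)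

theorem convex_Ici_prod (a b : ℝ) : Convex ℝ (Ici a ×ˢ Ici b : Set (ℝ × ℝ)) :=
  (convex_Ici a).prod (convex_Ici b)

namespace DecayingKernel

theorem norm_le {n : ℕ} (h : DecayingKernel n t H M B) (i j : Fin N) {x y : ℝ}
    (hx : t ≤ x) (hy : t ≤ y) : ‖H i j (x, y)‖ ≤ M x * B y := by
  simpa using h.norm_iteratedFDeriv_le i j 0 (Nat.zero_le n) x hx y hy

theorem norm_fderiv_le {n : ℕ} (h : DecayingKernel n t H M B) (hn : 1 ≤ n) (i j : Fin N)
    {x y : ℝ} (hx : t ≤ x) (hy : t ≤ y) : ‖fderiv ℝ (H i j) (x, y)‖ ≤ M x * B y := by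
  simpa [norm_iteratedFDeriv_one] using h.norm_iteratedFDeriv_le i j 1 hn x hx y hy

theorem norm_fderiv_fderiv_le (h : DecayingKernel 2 t H M B) (i j : Fin N)
    {x y : ℝ} (hx : t ≤ x) (hy : t ≤ y) :
    ‖fderiv ℝ (fderiv ℝ (H i j)) (x, y)‖ ≤ M x * B y := by
  have := h.norm_iteratedFDeriv_le i j 2 le_rfl x hx y hy
  rwa [show (2 : ℕ) = 1 + 1 from rfl, ← norm_iteratedFDeriv_fderiv,
    norm_iteratedFDeriv_one] at this

theorem differentiableAt {n : ℕ} (h : DecayingKernel n t H M B) (hn : 1 ≤ n) (i j : Fin N)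
    {p : ℝ × ℝ} (hp : p ∈ Ici t ×ˢ Ici t) : DifferentiableAt ℝ (H i j) p :=
  (h.contDiffAt i j p.1 hp.1 p.2 hp.2).differentiableAt (by exact_mod_cast (by omega : n ≠ 0))

theorem differentiableAt_fderiv (h : DecayingKernel 2 t H M B) (i j : Fin N)
    {p : ℝ × ℝ} (hp : p ∈ Ici t ×ˢ Ici t) : DifferentiableAt ℝ (fderiv ℝ (H i j)) p :=
  ((h.contDiffAt i j p.1 hp.1 p.2 hp.2).fderiv_right (m := 1) (by norm_num)).differentiableAt
    one_ne_zero

theorem norm_fderiv_sub_le (h : DecayingKernel 2 t H M B) (i j : Fin N) {a b : ℝ}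
    (ha : t ≤ a) (hb : t ≤ b) {p p' : ℝ × ℝ} (hp : p ∈ Ici a ×ˢ Ici b)
    (hp' : p' ∈ Ici a ×ˢ Ici b) :
    ‖fderiv ℝ (H i j) p' - fderiv ℝ (H i j) p‖ ≤ M a * B b * ‖p' - p‖ := by
  refine (convex_Ici_prod a b).norm_image_sub_le_of_norm_fderiv_le (𝕜 := ℝ)
    (fun z hz => h.differentiableAt_fderiv i j ⟨ha.trans hz.1, hb.trans hz.2⟩)
    (fun z hz => ?_) hp hp'
  exact (h.norm_fderiv_fderiv_le i j (ha.trans hz.1) (hb.trans hz.2)).trans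
    (h.mul_le ha hz.1 hb hz.2)

/-- Taylor's formula on a quadrant, where monotonicity puts the bound at the corner. The corner (a,
b) is left free: taking a to move with the integration variable keeps the remainder integrable. -/
theorem norm_sub_sub_fderiv_le (h : DecayingKernel 2 t H M B) (i j : Fin N) {a b : ℝ}
    (ha : t ≤ a) (hb : t ≤ b) {p p' : ℝ × ℝ} (hp : p ∈ Ici a ×ˢ Ici b)
    (hp' : p' ∈ Ici a ×ˢ Ici b) :
    ‖H i j p' - H i j p - fderiv ℝ (H i j) p (p' - p)‖ ≤ M a * B b * ‖p' - p‖ ^ 2 := by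
  have hseg : segment ℝ p p' ⊆ Ici a ×ˢ Ici b := (convex_Ici_prod a b).segment_subset hp hp'
  have := (convex_segment p p').norm_image_sub_le_of_norm_fderiv_le' (𝕜 := ℝ)
    (f := H i j) (φ := fderiv ℝ (H i j) p) (C := M a * B b * ‖p' - p‖)
    (fun z hz => h.differentiableAt one_le_two i j
      ⟨ha.trans (hseg hz).1, hb.trans (hseg hz).2⟩)
    (fun z hz => (h.norm_fderiv_sub_le i j ha hb hp (hseg hz)).trans ?_)
    (left_mem_segment ℝ p p') (right_mem_segment ℝ p p')
  · rwa [mul_assoc, ← sq] at this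
  · refine mul_le_mul_of_nonneg_left ?_ (mul_nonneg (h.nonneg_left a ha) (h.nonneg_right b hb))
    obtain ⟨c, hc, rfl⟩ := (segment_eq_image' ℝ p p' ▸ hz :)
    rw [add_sub_cancel_left, norm_smul, Real.norm_of_nonneg hc.1]
    exact mul_le_of_le_one_left (norm_nonneg _) hc.2

/-- The tame notion suffices to define the operator, and unlike C² smoothness it passes to the first
derivatives of a C² kernel and to single columns. -/
theorem tame {n : ℕ} (h : DecayingKernel n t H M B) (hn : 1 ≤ n) : TameKernel t H M B where
  toDecayBounds := h.toDecayBounds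
  norm_le i j _ hx _ hy := h.norm_le i j hx hy
  lipschitz i j _ hp _ hp' :=
    (convex_Ici_prod t t).norm_image_sub_le_of_norm_fderiv_le (𝕜 := ℝ)
      (fun _ hz => h.differentiableAt hn i j hz)
      (fun _ hz => (h.norm_fderiv_le hn i j hz.1 hz.2).trans (h.mul_le le_rfl hz.1 le_rfl hz.2))
      hp hp'

theorem norm_fderiv_apply_le {n : ℕ} (h : DecayingKernel n t H M B) (hn : 1 ≤ n) (i j : Fin N)
    {x y : ℝ} (hx : t ≤ x) (hy : t ≤ y) {e : ℝ × ℝ} (he : ‖e‖ ≤ 1) :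
    ‖fderiv ℝ (H i j) (x, y) e‖ ≤ M x * B y := by
  refine (ContinuousLinearMap.le_opNorm _ _).trans ?_
  exact (mul_le_of_le_one_right (norm_nonneg _) he).trans (h.norm_fderiv_le hn i j hx hy)

theorem tame_fderiv_apply (h : DecayingKernel 2 t H M B) {e : ℝ × ℝ} (he : ‖e‖ ≤ 1) :
    TameKernel t (fun i j p => fderiv ℝ (H i j) p e) M B where
  toDecayBounds := h.toDecayBounds
  norm_le i j x hx y hy := h.norm_fderiv_apply_le one_le_two i j hx hy he
  lipschitz i j p hp p' hp' := by
    rw [← sub_apply]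
    refine (ContinuousLinearMap.le_opNorm _ _).trans ?_
    exact (mul_le_of_le_one_right (norm_nonneg _) he).trans
      (h.norm_fderiv_sub_le i j le_rfl le_rfl hp hp')

theorem tame_dFst (h : DecayingKernel 2 t H M B) : TameKernel t (dFst H) M B :=
  h.tame_fderiv_apply (by simp)

theorem tame_dSnd (h : DecayingKernel 2 t H M B) : TameKernel t (dSnd H) M B :=
  h.tame_fderiv_apply (by simp)

end DecayingKernel

namespace TameKernel

theorem onlyColumn (h : TameKernel t H M B) (k : Fin N) : TameKernel t (onlyColumn k H) M B where
  toDecayBounds := h.toDecayBounds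
  norm_le i j x hx y hy := by
    unfold _root_.onlyColumn
    split_ifs
    · exact h.norm_le i j x hx y hy
    · simpa using mul_nonneg (h.nonneg_left x hx) (h.nonneg_right y hy)
  lipschitz i j p hp p' hp' := by
    unfold _root_.onlyColumn
    split_ifs
    · exact h.lipschitz i j p hp p' hp'
    · simpa using mul_nonneg (mul_nonneg (h.nonneg_left t le_rfl) (h.nonneg_right t le_rfl))
        (norm_nonneg (p' - p))

theorem continuousOn (h : TameKernel t H M B) (i j : Fin N) :
    ContinuousOn (H i j) (Ici t ×ˢ Ici t) := by
  refine LipschitzOnWith.continuousOn (K := (M t * B t).toNNReal)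
    (LipschitzOnWith.of_dist_le_mul fun p hp p' hp' => ?_)
  rw [dist_eq_norm, dist_eq_norm, Real.coe_toNNReal _
    (mul_nonneg (h.nonneg_left t le_rfl) (h.nonneg_right t le_rfl))]
  exact h.lipschitz i j p' hp' p hp

end TameKernel

/-- The row `s' ↦ H_lj(x, s' - vʲ)`, constant for `s' ≤ s`. -/
def kernelRow (H : Fin N → Fin N → ℝ × ℝ → ℂ) (s : ℝ) (l : Fin N) (x : ℝ) (v : Fin N → ℝ) :
    RowSpace N :=
  toBounded fun s' j => H l j (x, max s' s - v j)

/-- The integral operator with kernel `H_lj(q - vˡ, s' - vʲ)`. -/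
def kernelOp (H : Fin N → Fin N → ℝ × ℝ → ℂ) (s : ℝ) (v : Fin N → ℝ) :
    RowSpace N →L[ℝ] RowSpace N :=
  ∑ l, rowIntegral N s l (fun q => kernelRow H s l (q - v l) v)

namespace TameKernel

variable {s x : ℝ} {v : Fin N → ℝ}

theorem le_clip (hv : ∀ j, t ≤ s - v j) (s' : ℝ) (j : Fin N) : t ≤ max s' s - v j :=
  (hv j).trans (sub_le_sub_right (le_max_right _ _) _)

theorem kernelRow_apply (h : TameKernel t H M B) (hv : ∀ j, t ≤ s - v j) (hx : t ≤ x)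
    (l : Fin N) (s' : ℝ) (j : Fin N) :
    kernelRow H s l x v s' j = H l j (x, max s' s - v j) := by
  rw [kernelRow, toBounded_apply (C := M t * B t)]
  · refine continuous_pi fun j => (h.continuousOn l j).comp_continuous (by fun_prop) fun s' => ?_
    exact ⟨hx, le_clip hv s' j⟩
  · intro s'
    refine (pi_norm_le_iff_of_nonneg
      (mul_nonneg (h.nonneg_left t le_rfl) (h.nonneg_right t le_rfl))).2 fun j => ?_
    exact (h.norm_le l j x hx _ (le_clip hv s' j)).trans
      (h.mul_le le_rfl hx le_rfl (le_clip hv s' j))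

theorem norm_row_le {k : RowSpace N} {C : ℝ} (hC : 0 ≤ C) (h : ∀ s' j, ‖k s' j‖ ≤ C) :
    ‖k‖ ≤ C :=
  (BoundedContinuousFunction.norm_le hC).2 fun s' => (pi_norm_le_iff_of_nonneg hC).2 (h s')

theorem norm_kernelRow_le (h : TameKernel t H M B) (hv : ∀ j, t ≤ s - v j) (hx : t ≤ x)
    (l : Fin N) : ‖kernelRow H s l x v‖ ≤ M x * B t := by
  refine norm_row_le (mul_nonneg (h.nonneg_left x hx) (h.nonneg_right t le_rfl)) fun s' j => ?_
  rw [h.kernelRow_apply hv hx]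
  exact (h.norm_le l j x hx _ (le_clip hv s' j)).trans
    (h.mul_le hx le_rfl le_rfl (le_clip hv s' j))

/-- The Lipschitz bound is uniform in the second argument, hence gives continuity in the sup norm.
This supplies the strong measurability needed to integrate row-valued functions. -/
theorem continuousOn_kernelRow (h : TameKernel t H M B) (hv : ∀ j, t ≤ s - v j) (l : Fin N) :
    ContinuousOn (fun x => kernelRow H s l x v) (Ici t) := by
  have hC := mul_nonneg (h.nonneg_left t le_rfl) (h.nonneg_right t le_rfl)
  refine LipschitzOnWith.continuousOn (K := (M t * B t).toNNReal)
    (LipschitzOnWith.of_dist_le_mul fun x hx x' hx' => ?_)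
  rw [dist_eq_norm, dist_eq_norm, Real.coe_toNNReal _ hC]
  refine norm_row_le (mul_nonneg hC (norm_nonneg _)) fun s' j => ?_
  rw [BoundedContinuousFunction.sub_apply, Pi.sub_apply, h.kernelRow_apply hv hx,
    h.kernelRow_apply hv hx']
  refine (h.lipschitz l j (x', _) ⟨hx', le_clip hv s' j⟩ (x, _) ⟨hx, le_clip hv s' j⟩).trans_eq ?_
  simp [Prod.norm_def]

theorem integrableOn_comp_sub {M : ℝ → ℝ} (hM : IntegrableOn M (Ici t)) {a : ℝ}
    (ha : t ≤ s - a) : IntegrableOn (fun q => M (q - a)) (Ioi s) := by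
  have := (measurePreserving_sub_right (volume : Measure ℝ) a).integrableOn_comp_preimage
    (measurableEmbedding_subRight a) (f := M) (s := Ici t)
  refine (this.2 hM).mono_set fun q hq => ?_
  have : s < q := hq
  simp only [mem_preimage, mem_Ici]
  linarith

theorem integrableOn_kernelRow (h : TameKernel t H M B) (hv : ∀ j, t ≤ s - v j) (l : Fin N) :
    IntegrableOn (fun q => kernelRow H s l (q - v l) v) (Ioi s) := by
  have hmem : ∀ q ∈ Ioi s, t ≤ q - v l := fun q hq =>
    (hv l).trans (sub_le_sub_right (le_of_lt hq) _)
  refine Integrable.mono' ((integrableOn_comp_sub h.integrable_left (hv l)).mul_const (B t))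
    ?_ ?_
  · refine ContinuousOn.aestronglyMeasurable ?_ measurableSet_Ioi
    exact (h.continuousOn_kernelRow hv l).comp (by fun_prop) hmem
  · exact (ae_restrict_iff' measurableSet_Ioi).2
      (Eventually.of_forall fun q hq => h.norm_kernelRow_le hv (hmem q hq) l)

/-- Evaluation at (s', j) is a continuous functional, so it commutes with the Bochner integral; this
links the abstract operator to the pointwise integral equation. -/
theorem rowIntegral_kernelRow_apply (h : TameKernel t H M B) (hv : ∀ j, t ≤ s - v j)
    (l m : Fin N) (k : RowSpace N) (s' : ℝ) (j : Fin N) :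
    IntegrableOn (fun q => k q m * H l j (q - v l, max s' s - v j)) (Ioi s) ∧
    rowIntegral N s m (fun q => kernelRow H s l (q - v l) v) k s' j
      = ∫ q in Ioi s, k q m * H l j (q - v l, max s' s - v j) := by
  have hint := h.integrableOn_kernelRow hv l
  let ev : RowSpace N →L[ℝ] ℂ :=
    (ContinuousLinearMap.proj (R := ℝ) (φ := fun _ : Fin N => ℂ) j).comp
      (BoundedContinuousFunction.evalCLM ℝ s')
  have heq : ∀ q ∈ Ioi s, ev (k q m • kernelRow H s l (q - v l) v)
      = k q m * H l j (q - v l, max s' s - v j) := fun q hq => by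
    rw [← h.kernelRow_apply hv ((hv l).trans (sub_le_sub_right (le_of_lt hq) _))]
    rfl
  refine ⟨(ev.integrable_comp (hint.row_smul k m)).congr ?_, ?_⟩
  · exact (ae_restrict_iff' measurableSet_Ioi).2 (Eventually.of_forall heq)
  · rw [rowIntegral_apply m hint, ← setIntegral_congr_fun measurableSet_Ioi heq,
      ContinuousLinearMap.integral_comp_comm ev (hint.row_smul k m)]
    rfl

theorem kernelOp_apply (h : TameKernel t H M B) (hv : ∀ j, t ≤ s - v j)
    (k : RowSpace N) (s' : ℝ) (j : Fin N) :
    kernelOp H s v k s' j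
      = ∫ q in Ioi s, ∑ l, k q l * H l j (q - v l, max s' s - v j) := by
  rw [integral_finsetSum _ fun l _ => (h.rowIntegral_kernelRow_apply hv l l k s' j).1, kernelOp,
    sum_apply]
  simp only [BoundedContinuousFunction.sum_apply, Finset.sum_apply]
  exact Finset.sum_congr rfl fun l _ => (h.rowIntegral_kernelRow_apply hv l l k s' j).2

theorem kernelOp_isCompactOperator (h : TameKernel t H M B) (hv : ∀ j, t ≤ s - v j) :
    IsCompactOperator (kernelOp H s v) := by
  rw [kernelOp]
  exact Submodule.sum_mem (compactOperator (RingHom.id ℝ) (RowSpace N) (RowSpace N))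
    fun l _ => rowIntegral_isCompactOperator l (h.integrableOn_kernelRow hv l)

end TameKernel

end Kernel

/-! ### Differentiating the operator in the translation parameter -/

section KernelDeriv

set_option maxSynthPendingDepth 3

variable {N : ℕ} {t s : ℝ} {H : Fin N → Fin N → ℝ × ℝ → ℂ} {M B : ℝ → ℝ}

/-- The derivative at `v = 0` of `v ↦ kernelRow H s l (q - vˡ) v`. -/
def kernelRowDeriv (H : Fin N → Fin N → ℝ × ℝ → ℂ) (s : ℝ) (l : Fin N) (q : ℝ) :
    (Fin N → ℝ) →L[ℝ] RowSpace N :=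
  ∑ k, (ContinuousLinearMap.proj (R := ℝ) (φ := fun _ : Fin N => ℝ) k).smulRight
    (-((if k = l then kernelRow (dFst H) s l q 0 else 0)
      + kernelRow (onlyColumn k (dSnd H)) s l q 0))

/-- The partial derivative `∂/∂vᵏ` at `v = 0` of `kernelOp H s v`. -/
def kernelOpPartial (H : Fin N → Fin N → ℝ × ℝ → ℂ) (s : ℝ) (k : Fin N) :
    RowSpace N →L[ℝ] RowSpace N :=
  -(rowIntegral N s k (fun q => kernelRow (dFst H) s k q 0)
    + ∑ l, rowIntegral N s l (fun q => kernelRow (onlyColumn k (dSnd H)) s l q 0))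

/-- The derivative at `v = 0` of `v ↦ kernelOp H s v`. -/
def kernelOpDeriv (H : Fin N → Fin N → ℝ × ℝ → ℂ) (s : ℝ) :
    (Fin N → ℝ) →L[ℝ] RowSpace N →L[ℝ] RowSpace N :=
  ∑ k, (ContinuousLinearMap.proj (R := ℝ) (φ := fun _ : Fin N => ℝ) k).smulRight
    (kernelOpPartial H s k)

theorem kernelRowDeriv_single (l k : Fin N) (q : ℝ) :
    kernelRowDeriv H s l q (Pi.single k 1)
      = -((if k = l then kernelRow (dFst H) s l q 0 else 0)
      + kernelRow (onlyColumn k (dSnd H)) s l q 0) := by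
  rw [kernelRowDeriv, sum_apply, Finset.sum_eq_single k]
  · simp
  · intro b _ hb
    simp [hb]
  · simp

theorem kernelOpDeriv_single (k : Fin N) :
    kernelOpDeriv H s (Pi.single k 1) = kernelOpPartial H s k := by
  rw [kernelOpDeriv, sum_apply, Finset.sum_eq_single k]
  · simp
  · intro b _ hb
    simp [hb]
  · simp

namespace TameKernel

theorem le_sub_zero (hts : t ≤ s) (j : Fin N) : t ≤ s - (0 : Fin N → ℝ) j := by simpa

theorem integrableOn_kernelRow_zero (h : TameKernel t H M B) (hts : t ≤ s) (l : Fin N) :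
    IntegrableOn (fun q => kernelRow H s l q 0) (Ioi s) := by
  simpa using h.integrableOn_kernelRow (le_sub_zero hts) l

theorem kernelRow_zero_apply (h : TameKernel t H M B) (hts : t ≤ s) {x : ℝ} (hx : t ≤ x)
    (l : Fin N) (s' : ℝ) (j : Fin N) : kernelRow H s l x 0 s' j = H l j (x, max s' s) := by
  simpa using h.kernelRow_apply (le_sub_zero hts) hx l s' j

end TameKernel

namespace DecayingKernel

/-- The Taylor remainder is taken uniformly in s'. As ‖v‖ < s - t, both the original and the shifted
point lie in the quadrant with corner (q - (s - t), t), which gives a bound integrable in q. -/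
theorem norm_kernelRow_sub_le (h : DecayingKernel 2 t H M B) {v : Fin N → ℝ}
    (hv : ‖v‖ < s - t) (l : Fin N) {q : ℝ} (hq : s ≤ q) :
    ‖kernelRow H s l (q - v l) v - kernelRow H s l q 0 - kernelRowDeriv H s l q v‖
      ≤ M (q - (s - t)) * B t * ‖v‖ ^ 2 := by
  have hvj : ∀ j, |v j| ≤ ‖v‖ := fun j => by simpa using norm_le_pi_norm v j
  have hts : t ≤ s := by linarith [norm_nonneg v]
  have hvt : ∀ j, t ≤ s - v j := fun j => by linarith [hvj j, le_abs_self (v j)]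
  have ha : t ≤ q - (s - t) := by linarith
  refine TameKernel.norm_row_le (mul_nonneg (mul_nonneg (h.nonneg_left _ ha)
    (h.nonneg_right t le_rfl)) (sq_nonneg _)) fun s' j => ?_
  have hc := TameKernel.le_clip hvt s' j
  have hq' : q - (s - t) ≤ q - v l := by linarith [hvj l, le_abs_self (v l)]
  have hp : ((q, max s' s) : ℝ × ℝ) ∈ Ici (q - (s - t)) ×ˢ Ici t :=
    ⟨by simp only [mem_Ici]; linarith, hts.trans (le_max_right _ _)⟩
  have hp' : ((q - v l, max s' s - v j) : ℝ × ℝ) ∈ Ici (q - (s - t)) ×ˢ Ici t := ⟨hq', hc⟩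
  have key := h.norm_sub_sub_fderiv_le l j ha le_rfl hp hp'
  have hsub : ((q - v l, max s' s - v j) : ℝ × ℝ) - (q, max s' s)
      = (-v l) • ((1 : ℝ), (0 : ℝ)) + (-v j) • ((0 : ℝ), (1 : ℝ)) := by
    ext <;> simp
  have hnorm : ‖((q - v l, max s' s - v j) : ℝ × ℝ) - (q, max s' s)‖ ≤ ‖v‖ := by
    rw [Prod.norm_def]
    exact max_le (by simpa using hvj l) (by simpa using hvj j)
  have hder : kernelRowDeriv H s l q v s' j
      = fderiv ℝ (H l j) (q, max s' s) ((q - v l, max s' s - v j) - (q, max s' s)) := by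
    rw [hsub, map_add, map_smul, map_smul, kernelRowDeriv, sum_apply]
    have hsum : ∀ k, ((ContinuousLinearMap.proj (R := ℝ) (φ := fun _ : Fin N => ℝ) k).smulRight
        (-((if k = l then kernelRow (dFst H) s l q 0 else 0)
          + kernelRow (onlyColumn k (dSnd H)) s l q 0)) v) s' j
        = (if k = l then (-v k) • dFst H l j (q, max s' s) else 0)
          + if j = k then (-v k) • dSnd H l j (q, max s' s) else 0 := fun k => by
      have e1 := h.tame_dFst.kernelRow_zero_apply hts (hts.trans hq) l s' j
      have e2 := (h.tame_dSnd.onlyColumn k).kernelRow_zero_apply hts (hts.trans hq) l s' j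
      rw [ContinuousLinearMap.smulRight_apply, ContinuousLinearMap.proj_apply, smul_neg,
        ← neg_smul, BoundedContinuousFunction.smul_apply, BoundedContinuousFunction.add_apply,
        Pi.smul_apply, Pi.add_apply, e2, smul_add, onlyColumn]
      congr 1
      · by_cases hk : k = l
        · rw [if_pos hk, if_pos hk, e1]
        · rw [if_neg hk, if_neg hk]
          simp
      · by_cases hj : j = k
        · rw [if_pos hj, if_pos hj]
        · rw [if_neg hj, if_neg hj, smul_zero]
    simp only [BoundedContinuousFunction.sum_apply, Finset.sum_apply, hsum]
    simp [Finset.sum_add_distrib, dFst, dSnd]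
  rw [BoundedContinuousFunction.sub_apply, BoundedContinuousFunction.sub_apply, Pi.sub_apply,
    Pi.sub_apply, h.tame one_le_two |>.kernelRow_apply hvt (ha.trans hq'),
    h.tame one_le_two |>.kernelRow_zero_apply hts (hts.trans hq), hder]
  refine key.trans ?_
  exact mul_le_mul_of_nonneg_left (pow_le_pow_left₀ (norm_nonneg _) hnorm 2)
    (mul_nonneg (h.nonneg_left _ ha) (h.nonneg_right t le_rfl))

theorem hasFDerivAt_kernelRow (h : DecayingKernel 2 t H M B) (hts : t < s) (l : Fin N) :
    HasFDerivAt (fun v : Fin N → ℝ => kernelRow H s l (s - v l) v)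
      (kernelRowDeriv H s l s) 0 := by
  refine hasFDerivAt_of_norm_sub_le_sq (C := M (s - (s - t)) * B t) (sub_pos.2 hts)
    fun v hv => ?_
  simpa using h.norm_kernelRow_sub_le hv l le_rfl

theorem kernelOpDeriv_apply_eq (h : DecayingKernel 2 t H M B) (hts : t ≤ s) (v : Fin N → ℝ) :
    kernelOpDeriv H s v = ∑ l, rowIntegral N s l (fun q => kernelRowDeriv H s l q v) ∧
    ∀ l, IntegrableOn (fun q => kernelRowDeriv H s l q v) (Ioi s) := by
  have h1 : ∀ l k, IntegrableOn
      (fun q => v k • if k = l then kernelRow (dFst H) s l q 0 else 0) (Ioi s) := fun l k => by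
    refine Integrable.smul (v k) (f := fun q => if k = l then kernelRow (dFst H) s l q 0 else 0) ?_
    by_cases hk : k = l
    · simp only [hk, if_true]
      exact h.tame_dFst.integrableOn_kernelRow_zero hts l
    · simp [hk]
  have h2 : ∀ l k, IntegrableOn
      (fun q => v k • kernelRow (onlyColumn k (dSnd H)) s l q 0) (Ioi s) := fun l k =>
    Integrable.smul (v k) ((h.tame_dSnd.onlyColumn k).integrableOn_kernelRow_zero hts l)
  have h3 : ∀ l k, IntegrableOn
      (fun q => (v k • if k = l then kernelRow (dFst H) s l q 0 else 0)
        + v k • kernelRow (onlyColumn k (dSnd H)) s l q 0) (Ioi s) := fun l k =>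
    Integrable.add (h1 l k) (h2 l k)
  have hexp : ∀ l, (fun q => kernelRowDeriv H s l q v)
      = fun q => ∑ k, (-1 : ℝ) • ((v k • if k = l then kernelRow (dFst H) s l q 0 else 0)
        + v k • kernelRow (onlyColumn k (dSnd H)) s l q 0) := fun l => by
    funext q
    rw [kernelRowDeriv, sum_apply]
    refine Finset.sum_congr rfl fun k _ => ?_
    simp only [ContinuousLinearMap.smulRight_apply, ContinuousLinearMap.proj_apply]
    rw [← smul_add (v k), smul_neg, neg_one_smul]
  have h12 : ∀ l k, IntegrableOn (fun q => (-1 : ℝ) •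
      ((v k • if k = l then kernelRow (dFst H) s l q 0 else 0)
        + v k • kernelRow (onlyColumn k (dSnd H)) s l q 0)) (Ioi s) := fun l k =>
    Integrable.smul (-1 : ℝ) (h3 l k)
  refine ⟨?_, fun l => ?_⟩
  · have hl : ∀ l, rowIntegral N s l (fun q => kernelRowDeriv H s l q v)
        = ∑ k, (-1 : ℝ) • ((v k • if k = l then
            rowIntegral N s l (fun q => kernelRow (dFst H) s l q 0) else 0)
          + v k • rowIntegral N s l (fun q => kernelRow (onlyColumn k (dSnd H)) s l q 0)) := by
      intro l
      rw [hexp, rowIntegral_sum l _ fun k _ => h12 l k]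
      refine Finset.sum_congr rfl fun k _ => ?_
      rw [rowIntegral_smul l (h3 l k), rowIntegral_add l (h1 l k) (h2 l k),
        rowIntegral_smul l ((h.tame_dSnd.onlyColumn k).integrableOn_kernelRow_zero hts l)]
      by_cases hk : k = l
      · simp only [hk, if_true]
        rw [rowIntegral_smul l (h.tame_dFst.integrableOn_kernelRow_zero hts l)]
      · simp only [hk, if_false, smul_zero]
        congr 2
        ext1 k
        rw [rowIntegral_apply l (by simp)]
        simp
    rw [Finset.sum_congr rfl fun l _ => hl l, Finset.sum_comm, kernelOpDeriv, sum_apply]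
    refine Finset.sum_congr rfl fun k _ => ?_
    simp only [ContinuousLinearMap.smulRight_apply, ContinuousLinearMap.proj_apply,
      kernelOpPartial, ← Finset.smul_sum, Finset.sum_add_distrib, Finset.sum_ite_eq,
      Finset.mem_univ, if_true]
    rw [smul_neg, neg_one_smul, smul_add]
  · rw [hexp]
    exact integrable_finsetSum _ fun k _ => h12 l k

/-- The operator norm of the remainder is bounded by the L¹ norm of the remainder of the rows, which
is quadratic in v. -/
theorem hasFDerivAt_kernelOp (h : DecayingKernel 2 t H M B) (hts : t < s) :
    HasFDerivAt (fun v : Fin N → ℝ => kernelOp H s v) (kernelOpDeriv H s) 0 := by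
  have hM : IntegrableOn (fun q => M (q - (s - t))) (Ioi s) :=
    TameKernel.integrableOn_comp_sub h.integrable_left (by linarith)
  refine hasFDerivAt_of_norm_sub_le_sq (sub_pos.2 hts)
    (C := ∑ _l : Fin N, (∫ q in Ioi s, M (q - (s - t))) * B t) fun v hv => ?_
  have hvt : ∀ j, t ≤ s - v j := fun j => by
    have : |v j| ≤ ‖v‖ := by simpa using norm_le_pi_norm v j
    linarith [le_abs_self (v j)]
  obtain ⟨hd, hdi⟩ := h.kernelOpDeriv_apply_eq hts.le v
  have hi1 := fun l => (h.tame one_le_two).integrableOn_kernelRow hvt l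
  have hi0 := fun l => (h.tame one_le_two).integrableOn_kernelRow (TameKernel.le_sub_zero hts.le) l
  rw [hd, kernelOp, kernelOp, ← Finset.sum_sub_distrib, ← Finset.sum_sub_distrib, Finset.sum_mul]
  refine norm_sum_le_of_le _ fun l _ => ?_
  rw [← rowIntegral_sub l (hi1 l) (hi0 l), ← rowIntegral_sub (φ := fun q => kernelRow H s l (q - v l) v
      - kernelRow H s l (q - (0 : Fin N → ℝ) l) 0) l ((hi1 l).sub (hi0 l)) (hdi l)]
  refine (norm_rowIntegral_le l (((hi1 l).sub (hi0 l)).sub (hdi l))).trans ?_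
  rw [mul_assoc, ← integral_mul_const]
  refine integral_mono_of_nonneg (Eventually.of_forall fun _ => norm_nonneg _)
    (hM.mul_const _) ?_
  refine (ae_restrict_iff' measurableSet_Ioi).2 (Eventually.of_forall fun q hq => ?_)
  simpa [mul_assoc] using h.norm_kernelRow_sub_le hv l (le_of_lt hq)

end DecayingKernel

end KernelDeriv

/-! ### The right side of the row equation as a function of s' -/

/-- A matrix kernel continuous on the quadrant `x, y ≥ t` and bounded there by `M(x) B(y)`. -/
structure DominatedKernel {N : ℕ} (t : ℝ) (G : Fin N → Fin N → ℝ × ℝ → ℂ)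
    (M B : ℝ → ℝ) : Prop extends DecayBounds t M B where
  continuousOn : ∀ i j, ContinuousOn (G i j) (Ici t ×ˢ Ici t)
  norm_le : ∀ i j, ∀ x ≥ t, ∀ y ≥ t, ‖G i j (x, y)‖ ≤ M x * B y

/-- A row of functions continuous on `[s, ∞)` and bounded there by `C`. -/
structure BoundedRow {N : ℕ} (s : ℝ) (κ : Fin N → ℝ → ℂ) (C : ℝ) : Prop where
  continuousOn : ∀ l, ContinuousOn (κ l) (Ici s)
  norm_le : ∀ l, ∀ q ≥ s, ‖κ l q‖ ≤ C

/-- The row `y ↦ G_ij(s, y) + ∫_s^∞ ∑_l κ_l(q) G_lj(q, y) dq`. -/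
def rowTransform {N : ℕ} (G : Fin N → Fin N → ℝ × ℝ → ℂ) (s : ℝ) (i : Fin N)
    (κ : Fin N → ℝ → ℂ) (j : Fin N) (y : ℝ) : ℂ :=
  G i j (s, y) + ∫ q in Ioi s, ∑ l, κ l q * G l j (q, y)

section Transform

variable {N : ℕ} {t s : ℝ} {H G : Fin N → Fin N → ℝ × ℝ → ℂ} {M B : ℝ → ℝ}
  {κ : Fin N → ℝ → ℂ} {C : ℝ}

theorem DecayingKernel.dominated {n : ℕ} (h : DecayingKernel n t H M B) :
    DominatedKernel t H M B where
  toDecayBounds := h.toDecayBounds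
  continuousOn i j p hp :=
    (h.contDiffAt i j p.1 hp.1 p.2 hp.2).continuousAt.continuousWithinAt
  norm_le i j _ hx _ hy := h.norm_le i j hx hy

/-- The weighted kernel is only C¹, so its derivative is merely continuous and need not be tame. -/
theorem DecayingKernel.dominated_dSnd {n : ℕ} (h : DecayingKernel n t H M B) (hn : 1 ≤ n) :
    DominatedKernel t (dSnd H) M B where
  toDecayBounds := h.toDecayBounds
  continuousOn i j p hp := by
    have : ContinuousAt (fderiv ℝ (H i j)) p :=
      ((h.contDiffAt i j p.1 hp.1 p.2 hp.2).fderiv_right (m := 0)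
        (by simpa using (by exact_mod_cast hn : (1 : WithTop ℕ∞) ≤ n))).continuousAt
    exact (this.clm_apply continuousAt_const).continuousWithinAt
  norm_le i j _ hx _ hy := h.norm_fderiv_apply_le hn i j hx hy (by simp)

theorem BoundedRow.nonneg (hκ : BoundedRow s κ C) (l : Fin N) : 0 ≤ C :=
  (norm_nonneg _).trans (hκ.norm_le l s le_rfl)

namespace DominatedKernel

theorem continuousOn_left (h : DominatedKernel t G M B) (l j : Fin N) {y : ℝ} (hy : t ≤ y) :
    ContinuousOn (fun q => G l j (q, y)) (Ici t) :=
  (h.continuousOn l j).comp (by fun_prop) fun _ hq => ⟨hq, hy⟩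

theorem integrableOn_mul (h : DominatedKernel t G M B) (hts : t ≤ s) (hκ : BoundedRow s κ C)
    (l j : Fin N) {y : ℝ} (hy : t ≤ y) :
    IntegrableOn (fun q => κ l q * G l j (q, y)) (Ioi s) := by
  have hM : IntegrableOn M (Ioi s) :=
    h.integrable_left.mono_set fun q hq => hts.trans (le_of_lt hq)
  refine Integrable.mono' ((hM.mul_const (B y)).const_mul C) ?_ ?_
  · refine ContinuousOn.aestronglyMeasurable ?_ measurableSet_Ioi
    exact ((hκ.continuousOn l).mono Ioi_subset_Ici_self).mul
      ((h.continuousOn_left l j hy).mono fun q hq => hts.trans (le_of_lt hq))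
  · refine (ae_restrict_iff' measurableSet_Ioi).2 (Eventually.of_forall fun q hq => ?_)
    rw [norm_mul]
    exact mul_le_mul (hκ.norm_le l q (le_of_lt hq))
      (h.norm_le l j q (hts.trans (le_of_lt hq)) y hy) (norm_nonneg _) (hκ.nonneg l)

theorem rowTransform_eq (h : DominatedKernel t G M B) (hts : t ≤ s) (hκ : BoundedRow s κ C)
    (i j : Fin N) {y : ℝ} (hy : t ≤ y) :
    rowTransform G s i κ j y = G i j (s, y) + ∑ l, ∫ q in Ioi s, κ l q * G l j (q, y) := by
  rw [rowTransform, integral_finsetSum _ fun l _ => h.integrableOn_mul hts hκ l j hy]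

theorem norm_rowTransform_le (h : DominatedKernel t G M B) (hts : t ≤ s)
    (hκ : BoundedRow s κ C) (i j : Fin N) {y : ℝ} (hy : t ≤ y) :
    ‖rowTransform G s i κ j y‖ ≤ (M s + ∑ _l : Fin N, C * ∫ q in Ioi s, M q) * B y := by
  have hM : IntegrableOn M (Ioi s) :=
    h.integrable_left.mono_set fun q hq => hts.trans (le_of_lt hq)
  rw [h.rowTransform_eq hts hκ i j hy, add_mul, Finset.sum_mul]
  refine norm_add_le_of_le (h.norm_le i j s hts y hy) (norm_sum_le_of_le _ fun l _ => ?_)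
  rw [mul_assoc, ← integral_mul_const, ← integral_const_mul]
  refine norm_integral_le_of_norm_le ((hM.mul_const (B y)).const_mul C) ?_
  refine (ae_restrict_iff' measurableSet_Ioi).2 (Eventually.of_forall fun q hq => ?_)
  rw [norm_mul]
  exact mul_le_mul (hκ.norm_le l q (le_of_lt hq))
    (h.norm_le l j q (hts.trans (le_of_lt hq)) y hy) (norm_nonneg _) (hκ.nonneg l)

end DominatedKernel

theorem DecayingKernel.hasDerivAt_snd {n : ℕ} (h : DecayingKernel n t H M B) (hn : 1 ≤ n)
    (i j : Fin N) {x y : ℝ} (hx : t ≤ x) (hy : t ≤ y) :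
    HasDerivAt (fun y => H i j (x, y)) (dSnd H i j (x, y)) y := by
  have h1 : HasDerivAt (fun y : ℝ => (x, y)) ((0 : ℝ), (1 : ℝ)) y :=
    (hasDerivAt_const y x).prodMk (hasDerivAt_id y)
  exact (h.differentiableAt hn i j (p := (x, y)) ⟨hx, hy⟩).hasFDerivAt.comp_hasDerivAt y h1

theorem DecayingKernel.hasDerivAt_fst {n : ℕ} (h : DecayingKernel n t H M B) (hn : 1 ≤ n)
    (i j : Fin N) {x y : ℝ} (hx : t ≤ x) (hy : t ≤ y) :
    HasDerivAt (fun x => H i j (x, y)) (dFst H i j (x, y)) x := by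
  have h1 : HasDerivAt (fun x : ℝ => (x, y)) ((1 : ℝ), (0 : ℝ)) x :=
    (hasDerivAt_id x).prodMk (hasDerivAt_const x y)
  exact (h.differentiableAt hn i j (p := (x, y)) ⟨hx, hy⟩).hasFDerivAt.comp_hasDerivAt x h1

theorem DecayingKernel.hasDerivAt_rowTransform {n : ℕ} (h : DecayingKernel n t H M B)
    (hn : 1 ≤ n) (hts : t ≤ s) (hκ : BoundedRow s κ C) (i j : Fin N) {y : ℝ} (hy : t < y) :
    HasDerivAt (rowTransform H s i κ j) (rowTransform (dSnd H) s i κ j y) y := by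
  have hM : IntegrableOn M (Ioi s) :=
    h.integrable_left.mono_set fun q hq => hts.trans (le_of_lt hq)
  have hG := h.dominated_dSnd hn
  have hint : ∀ l, HasDerivAt (fun y => ∫ q in Ioi s, κ l q * H l j (q, y))
      (∫ q in Ioi s, κ l q * dSnd H l j (q, y)) y := fun l => by
    refine (hasDerivAt_integral_of_dominated_loc_of_deriv_le (Ioi_mem_nhds hy)
      (F := fun y q => κ l q * H l j (q, y)) (F' := fun y q => κ l q * dSnd H l j (q, y))
      (bound := fun q => C * (M q * B t)) ?_ (h.dominated.integrableOn_mul hts hκ l j hy.le)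
      (hG.integrableOn_mul hts hκ l j hy.le).aestronglyMeasurable ?_
      ((hM.mul_const (B t)).const_mul C) ?_).2
    · filter_upwards [Ioi_mem_nhds hy] with z hz
      exact (h.dominated.integrableOn_mul hts hκ l j (le_of_lt hz)).aestronglyMeasurable
    · refine (ae_restrict_iff' measurableSet_Ioi).2 (Eventually.of_forall fun q hq z hz => ?_)
      have hqt := hts.trans (le_of_lt hq)
      rw [norm_mul]
      exact mul_le_mul (hκ.norm_le l q (le_of_lt hq))
        ((hG.norm_le l j q hqt z (le_of_lt hz)).trans
          (h.mul_le hqt le_rfl le_rfl (le_of_lt hz))) (norm_nonneg _) (hκ.nonneg l)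
    · refine (ae_restrict_iff' measurableSet_Ioi).2 (Eventually.of_forall fun q hq z hz => ?_)
      exact (h.hasDerivAt_snd hn l j (hts.trans (le_of_lt hq)) (le_of_lt hz)).const_mul _
  rw [hG.rowTransform_eq hts hκ i j hy.le]
  refine ((h.hasDerivAt_snd hn i j hts hy.le).add
    (HasDerivAt.fun_sum (u := Finset.univ) fun l _ => hint l)).congr_of_eventuallyEq ?_
  filter_upwards [Ioi_mem_nhds hy] with z hz
  exact h.dominated.rowTransform_eq hts hκ i j (le_of_lt hz)

/-- On (s, ∞) this function is a derivative, and derivatives are measurable; continuity is not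
needed. -/
theorem DecayingKernel.aestronglyMeasurable_rowTransform_dSnd {n : ℕ}
    (h : DecayingKernel n t H M B) (hn : 1 ≤ n) (hts : t ≤ s) (hκ : BoundedRow s κ C)
    (i j : Fin N) :
    AEStronglyMeasurable (rowTransform (dSnd H) s i κ j) (volume.restrict (Ioi s)) := by
  refine (aestronglyMeasurable_deriv (rowTransform H s i κ j) _).congr ?_
  exact (ae_restrict_iff' measurableSet_Ioi).2 (Eventually.of_forall fun y hy =>
    (h.hasDerivAt_rowTransform hn hts hκ i j (hts.trans_lt hy)).deriv)

end Transform

/-! ### The quadratic identity from the skew symmetry of the weighted kernel -/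

section Symmetrization

variable {N : ℕ} {t s : ℝ} {H G : Fin N → Fin N → ℝ × ℝ → ℂ} {M B : ℝ → ℝ}
  {κ κ' : Fin N → ℝ → ℂ} {ρ : Fin N → ℝ → ℂ} {C C' : ℝ}

theorem DominatedKernel.integrable_prod (h : DominatedKernel t G M B) (hts : t ≤ s)
    (hκ : BoundedRow s κ C) (hκ' : BoundedRow s κ' C') (m l : Fin N) :
    Integrable (fun z : ℝ × ℝ => κ m z.1 * G m l z * κ' l z.2)
      ((volume.restrict (Ioi s)).prod (volume.restrict (Ioi s))) := by
  have hM : IntegrableOn M (Ioi s) :=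
    h.integrable_left.mono_set fun q hq => hts.trans (le_of_lt hq)
  have hB : IntegrableOn B (Ioi s) :=
    h.integrable_right.mono_set fun q hq => hts.trans (le_of_lt hq)
  refine Integrable.mono' ((hM.const_mul C).mul_prod (hB.mul_const C')) ?_ ?_
  · rw [Measure.prod_restrict]
    refine ContinuousOn.aestronglyMeasurable ?_ (measurableSet_Ioi.prod measurableSet_Ioi)
    refine (ContinuousOn.mul ?_ ?_).mul ?_
    · exact (hκ.continuousOn m).comp continuous_fst.continuousOn fun z hz => mem_Ici_of_Ioi hz.1
    · exact (h.continuousOn m l).mono fun z hz =>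
        ⟨hts.trans (le_of_lt hz.1), hts.trans (le_of_lt hz.2)⟩
    · exact (hκ'.continuousOn l).comp continuous_snd.continuousOn fun z hz => mem_Ici_of_Ioi hz.2
  · rw [Measure.prod_restrict]
    refine (ae_restrict_iff' (measurableSet_Ioi.prod measurableSet_Ioi)).2
      (Eventually.of_forall fun z hz => ?_)
    have h1 := hκ.norm_le m z.1 (le_of_lt hz.1)
    have h2 := h.norm_le m l z.1 (hts.trans (le_of_lt hz.1)) z.2 (hts.trans (le_of_lt hz.2))
    have h3 := hκ'.norm_le l z.2 (le_of_lt hz.2)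
    rw [norm_mul, norm_mul]
    calc ‖κ m z.1‖ * ‖G m l z‖ * ‖κ' l z.2‖ ≤ C * (M z.1 * B z.2) * C' := by
          refine mul_le_mul (mul_le_mul h1 h2 (norm_nonneg _) (hκ.nonneg m)) h3 (norm_nonneg _)
            (mul_nonneg (hκ.nonneg m) ((norm_nonneg _).trans h2))
      _ = C * M z.1 * (B z.2 * C') := by ring

/-- The expansion of `T_j(s) ρ_j(s) + ∫_s^∞ ∑_l T_l(q) κ'_l(q) ρ_l(q) dq` for the row
`T = rowTransform G s i κ`. -/
theorem DominatedKernel.pairing_eq (h : DominatedKernel t G M B) (hts : t ≤ s)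
    (hκ : BoundedRow s κ C) (hκ' : BoundedRow s (fun l q => κ' l q * ρ l q) C')
    (i j : Fin N) :
    rowTransform G s i κ j s * ρ j s
      + ∫ q in Ioi s, ∑ l, rowTransform G s i κ l q * (κ' l q * ρ l q)
    = G i j (s, s) * ρ j s + ∑ l, (∫ q in Ioi s, κ l q * (G l j (q, s) * ρ j s))
      + ∑ l, (∫ q in Ioi s, G i l (s, q) * ρ l q * κ' l q)
      + ∑ l, ∑ m, ∫ q in Ioi s, ∫ p in Ioi s, κ m p * (G m l (p, q) * ρ l q) * κ' l q := by
  have hB : IntegrableOn B (Ioi s) :=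
    h.integrable_right.mono_set fun q hq => hts.trans (le_of_lt hq)
  have hi1 : ∀ l, IntegrableOn (fun q => G i l (s, q) * ρ l q * κ' l q) (Ioi s) := fun l => by
    refine Integrable.mono' ((hB.const_mul (M s)).mul_const C') ?_ ?_
    · refine ContinuousOn.aestronglyMeasurable ?_ measurableSet_Ioi
      have : ContinuousOn (fun q => G i l (s, q) * (κ' l q * ρ l q)) (Ioi s) :=
        ((h.continuousOn i l).comp (f := fun q => (s, q)) (by fun_prop) fun q hq =>
          ⟨hts, hts.trans (le_of_lt hq)⟩).mul
          ((hκ'.continuousOn l).mono Ioi_subset_Ici_self)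
      exact this.congr fun q _ => by ring
    · refine (ae_restrict_iff' measurableSet_Ioi).2 (Eventually.of_forall fun q hq => ?_)
      rw [show G i l (s, q) * ρ l q * κ' l q = G i l (s, q) * (κ' l q * ρ l q) by ring, norm_mul]
      have h2 := h.norm_le i l s hts q (hts.trans (le_of_lt hq))
      exact mul_le_mul h2 (hκ'.norm_le l q (le_of_lt hq)) (norm_nonneg _)
        ((norm_nonneg _).trans h2)
  have hi2 : ∀ l m, IntegrableOn
      (fun q => ∫ p in Ioi s, κ m p * (G m l (p, q) * ρ l q) * κ' l q) (Ioi s) := fun l m => by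
    refine ((h.integrable_prod hts hκ hκ' m l).integral_prod_right).congr
      (Eventually.of_forall fun q => integral_congr_ae (Eventually.of_forall fun p => ?_))
    simp only
    ring
  have hsplit : ∀ q ∈ Ioi s, ∑ l, rowTransform G s i κ l q * (κ' l q * ρ l q)
      = ∑ l, (G i l (s, q) * ρ l q * κ' l q
        + ∑ m, ∫ p in Ioi s, κ m p * (G m l (p, q) * ρ l q) * κ' l q) := fun q hq => by
    refine Finset.sum_congr rfl fun l _ => ?_
    rw [h.rowTransform_eq hts hκ i l (hts.trans (le_of_lt hq)), add_mul, Finset.sum_mul]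
    congr 1
    · ring
    · refine Finset.sum_congr rfl fun m _ => ?_
      rw [← integral_mul_const]
      exact integral_congr_ae (Eventually.of_forall fun p => by simp only; ring)
  have hi3 : ∀ l, IntegrableOn
      (fun q => ∑ m, ∫ p in Ioi s, κ m p * (G m l (p, q) * ρ l q) * κ' l q) (Ioi s) :=
    fun l => integrable_finsetSum _ fun m _ => hi2 l m
  have hi4 : ∀ l, IntegrableOn (fun q => G i l (s, q) * ρ l q * κ' l q
      + ∑ m, ∫ p in Ioi s, κ m p * (G m l (p, q) * ρ l q) * κ' l q) (Ioi s) :=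
    fun l => Integrable.add (hi1 l) (hi3 l)
  rw [setIntegral_congr_fun measurableSet_Ioi hsplit, integral_finsetSum _ fun l _ => hi4 l,
    Finset.sum_congr rfl fun l _ => integral_add (hi1 l) (hi3 l), Finset.sum_add_distrib,
    Finset.sum_congr rfl fun l _ => integral_finsetSum _ fun m _ => hi2 l m,
    h.rowTransform_eq hts hκ i j hts, add_mul, Finset.sum_mul,
    ← add_assoc]
  congr 3
  refine Finset.sum_congr rfl fun l _ => ?_
  rw [← integral_mul_const]
  exact integral_congr_ae (Eventually.of_forall fun p => by simp only; ring)

/-- If `ρ_j(q) G_lj(p, q)` is skew, then so is the pairing of the transforms of two rows. -/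
theorem DominatedKernel.pairing_add_pairing (h : DominatedKernel t G M B) (hts : t ≤ s)
    (hκ : BoundedRow s κ C) (hκ' : BoundedRow s κ' C)
    (hκρ : BoundedRow s (fun l q => κ l q * ρ l q) C')
    (hκρ' : BoundedRow s (fun l q => κ' l q * ρ l q) C')
    (hskew : ∀ l j, ∀ p ≥ s, ∀ q ≥ s, G l j (p, q) * ρ j q = -(G j l (q, p) * ρ l p))
    (i j : Fin N) :
    (rowTransform G s i κ j s * ρ j s
      + ∫ q in Ioi s, ∑ l, rowTransform G s i κ l q * (κ' l q * ρ l q))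
    + (rowTransform G s j κ' i s * ρ i s
      + ∫ q in Ioi s, ∑ l, rowTransform G s j κ' l q * (κ l q * ρ l q)) = 0 := by
  rw [h.pairing_eq hts hκ hκρ' i j, h.pairing_eq hts hκ' hκρ j i]
  -- Skew symmetry cancels the two endpoint terms against each other, each single integral against
  -- one of the other kind in the transposed expansion, and the double integrals after exchanging
  -- the order of integration.
  have e1 : G j i (s, s) * ρ i s = -(G i j (s, s) * ρ j s) := hskew j i s le_rfl s le_rfl
  have e2 : ∀ (κ : Fin N → ℝ → ℂ) i l, (∫ q in Ioi s, G i l (s, q) * ρ l q * κ l q)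
      = -∫ q in Ioi s, κ l q * (G l i (q, s) * ρ i s) := fun κ i l => by
    rw [← integral_neg]
    refine setIntegral_congr_fun measurableSet_Ioi fun q hq => ?_
    rw [hskew i l s le_rfl q (le_of_lt hq)]
    ring
  have e4 : ∀ l m, (∫ q in Ioi s, ∫ p in Ioi s, κ' m p * (G m l (p, q) * ρ l q) * κ l q)
      = -∫ q in Ioi s, ∫ p in Ioi s, κ l p * (G l m (p, q) * ρ m q) * κ' m q := fun l m => by
    rw [integral_integral_swap, ← integral_neg]
    · refine setIntegral_congr_fun measurableSet_Ioi fun q hq => ?_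
      rw [← integral_neg]
      refine setIntegral_congr_fun measurableSet_Ioi fun p hp => ?_
      rw [hskew m l q (le_of_lt hq) p (le_of_lt hp)]
      ring
    · refine ((h.integrable_prod hts hκ' hκρ m l).swap).congr (Eventually.of_forall fun z => ?_)
      simp only [Function.comp, Function.uncurry, Prod.swap]
      ring
  rw [e1, Finset.sum_congr rfl fun l _ => e2 κ' i l, Finset.sum_congr rfl fun l _ => e2 κ j l,
    Finset.sum_congr (s₁ := Finset.univ) rfl fun l _ =>
      Finset.sum_congr (s₁ := Finset.univ) rfl fun m _ => e4 l m,
    Finset.sum_comm (f := fun l m =>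
      -∫ q in Ioi s, ∫ p in Ioi s, κ l p * (G l m (p, q) * ρ m q) * κ' m q)]
  simp only [Finset.sum_neg_distrib]
  ring

/-- On solutions, the weighted rows κρ and κ'ρ are the transforms themselves. The integral in the
vanishing symmetrized pairing is therefore that of the derivative of ∑ κ_l ρ_l κ'_l ρ_l, and only
the boundary value at s survives. -/
theorem DecayingKernel.rowTransform_dSnd_add (h : DecayingKernel 1 t H M B) (hts : t < s)
    (hκ : BoundedRow s κ C) (hκ' : BoundedRow s κ' C)
    (hρ : ∀ l, ContinuousOn (ρ l) (Ici s))
    (hskew : ∀ l j, ∀ p ≥ s, ∀ q ≥ s,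
      dSnd H l j (p, q) * ρ j q = -(dSnd H j l (q, p) * ρ l p))
    {i j : Fin N}
    (hi : ∀ l, ∀ q ≥ s, rowTransform H s i κ l q = κ l q * ρ l q)
    (hj : ∀ l, ∀ q ≥ s, rowTransform H s j κ' l q = κ' l q * ρ l q) :
    rowTransform (dSnd H) s i κ j s * ρ j s + rowTransform (dSnd H) s j κ' i s * ρ i s
      = ∑ l, (κ l s * ρ l s) * (κ' l s * ρ l s) := by
  have hG := h.dominated_dSnd le_rfl
  have hB : IntegrableOn B (Ioi s) :=
    h.integrable_right.mono_set fun q hq => hts.le.trans (le_of_lt hq)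
  set D := M s + ∑ _l : Fin N, C * ∫ q in Ioi s, M q with hD
  have hDn : 0 ≤ D := add_nonneg (h.nonneg_left s hts.le) (Finset.sum_nonneg fun l _ =>
    mul_nonneg (hκ.nonneg l) (setIntegral_nonneg measurableSet_Ioi fun q hq =>
      h.nonneg_left q (hts.le.trans (le_of_lt hq))))
  have hbd : ∀ {G : Fin N → Fin N → ℝ × ℝ → ℂ} (_ : DominatedKernel t G M B)
      {κ : Fin N → ℝ → ℂ} (_ : BoundedRow s κ C) (i l : Fin N), ∀ q ≥ s,
      ‖rowTransform G s i κ l q‖ ≤ D * B s := fun hG κ hκ i l q hq =>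
    (hG.norm_rowTransform_le hts.le hκ i l (hts.le.trans hq)).trans
      (mul_le_mul_of_nonneg_left (h.anti_right hts.le (hts.le.trans hq) hq) hDn)
  -- The weight ρ alone may be unbounded at infinity; the product κρ is bounded because it is a
  -- transform by the decaying weighted kernel.
  have hrow : ∀ {κ : Fin N → ℝ → ℂ} (_ : BoundedRow s κ C) (i : Fin N)
      (_ : ∀ l, ∀ q ≥ s, rowTransform H s i κ l q = κ l q * ρ l q),
      BoundedRow s (fun l q => κ l q * ρ l q) (D * B s) := fun hκ i hi =>
    ⟨fun l => (hκ.continuousOn l).mul (hρ l), fun l q hq =>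
      hi l q hq ▸ hbd h.dominated hκ i l q hq⟩
  have hderiv : ∀ {κ : Fin N → ℝ → ℂ} (_ : BoundedRow s κ C) (i l : Fin N), ∀ q ∈ Ici s,
      HasDerivAt (rowTransform H s i κ l) (rowTransform (dSnd H) s i κ l q) q :=
    fun hκ i l q hq => h.hasDerivAt_rowTransform le_rfl hts.le hκ i l (hts.trans_le hq)
  have hcont : ∀ {κ : Fin N → ℝ → ℂ} (_ : BoundedRow s κ C) (i l : Fin N),
      AEStronglyMeasurable (rowTransform H s i κ l) (volume.restrict (Ioi s)) :=
    fun hκ i l => ContinuousOn.aestronglyMeasurable (fun q hq =>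
      (hderiv hκ i l q (mem_Ici_of_Ioi hq)).continuousAt.continuousWithinAt) measurableSet_Ioi
  have hint : ∀ {G G' : Fin N → Fin N → ℝ × ℝ → ℂ} (_ : DominatedKernel t G M B)
      (_ : DominatedKernel t G' M B)
      {κ κ' : Fin N → ℝ → ℂ} (_ : BoundedRow s κ C) (_ : BoundedRow s κ' C) (i j l : Fin N)
      (_ : AEStronglyMeasurable (rowTransform G s i κ l) (volume.restrict (Ioi s)))
      (_ : AEStronglyMeasurable (rowTransform G' s j κ' l) (volume.restrict (Ioi s))),
      IntegrableOn (fun q => rowTransform G s i κ l q * rowTransform G' s j κ' l q) (Ioi s) :=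
    fun hG hG' κ κ' hκ hκ' i j l hm hm' => by
      refine Integrable.mono' ((hB.const_mul D).mul_const (D * B s)) (hm.mul hm') ?_
      refine (ae_restrict_iff' measurableSet_Ioi).2 (Eventually.of_forall fun q hq => ?_)
      rw [norm_mul]
      have h1 := hG.norm_rowTransform_le hts.le hκ i l (hts.le.trans (le_of_lt hq))
      exact mul_le_mul h1 (hbd hG' hκ' j l q (le_of_lt hq)) (norm_nonneg _)
        ((norm_nonneg _).trans h1)
  have hm := fun l => h.aestronglyMeasurable_rowTransform_dSnd le_rfl hts.le hκ i l
  have hm' := fun l => h.aestronglyMeasurable_rowTransform_dSnd le_rfl hts.le hκ' j l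
  have hi1 := fun l => hint hG h.dominated hκ hκ' i j l (hm l) (hcont hκ' j l)
  have hi2 := fun l => hint h.dominated hG hκ hκ' i j l (hcont hκ i l) (hm' l)
  have hi0 := fun l => hint h.dominated h.dominated hκ hκ' i j l (hcont hκ i l) (hcont hκ' j l)
  have hprod : ∀ l, ∀ q ∈ Ici s,
      HasDerivAt (fun q => rowTransform H s i κ l q * rowTransform H s j κ' l q)
        (rowTransform (dSnd H) s i κ l q * rowTransform H s j κ' l q
          + rowTransform H s i κ l q * rowTransform (dSnd H) s j κ' l q) q :=
    fun l q hq => (hderiv hκ i l q hq).mul (hderiv hκ' j l q hq)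
  have hparts : ∀ l, (∫ q in Ioi s, rowTransform (dSnd H) s i κ l q * rowTransform H s j κ' l q)
      + ∫ q in Ioi s, rowTransform H s i κ l q * rowTransform (dSnd H) s j κ' l q
      = -((κ l s * ρ l s) * (κ' l s * ρ l s)) := fun l => by
    rw [← integral_add (hi1 l) (hi2 l), integral_Ioi_of_hasDerivAt_of_tendsto' (hprod l)
      ((hi1 l).add (hi2 l)) (tendsto_zero_of_hasDerivAt_of_integrableOn_Ioi
        (fun q hq => hprod l q (mem_Ici_of_Ioi hq)) ((hi1 l).add (hi2 l)) (hi0 l)),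
      hi l s le_rfl, hj l s le_rfl, zero_sub]
  have hsk := hG.pairing_add_pairing hts.le hκ hκ' (hrow hκ i hi) (hrow hκ' j hj) hskew i j
  have e1 : (∫ q in Ioi s, ∑ l, rowTransform (dSnd H) s i κ l q * (κ' l q * ρ l q))
      = ∑ l, ∫ q in Ioi s, rowTransform (dSnd H) s i κ l q * rowTransform H s j κ' l q := by
    rw [← integral_finsetSum _ fun l _ => hi1 l]
    refine setIntegral_congr_fun measurableSet_Ioi fun q hq => ?_
    exact Finset.sum_congr rfl fun l _ => by rw [hj l q (le_of_lt hq)]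
  have e2 : (∫ q in Ioi s, ∑ l, rowTransform (dSnd H) s j κ' l q * (κ l q * ρ l q))
      = ∑ l, ∫ q in Ioi s, rowTransform H s i κ l q * rowTransform (dSnd H) s j κ' l q := by
    rw [← integral_finsetSum _ fun l _ => hi2 l]
    refine setIntegral_congr_fun measurableSet_Ioi fun q hq => ?_
    exact Finset.sum_congr rfl fun l _ => by rw [hi l q (le_of_lt hq), mul_comm]
  have hsum := Finset.sum_congr (s₁ := Finset.univ) rfl fun l _ => hparts l
  rw [Finset.sum_add_distrib, Finset.sum_neg_distrib] at hsum
  rw [e1, e2] at hsk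
  linear_combination hsk - hsum

end Symmetrization

/-! ### The u-derivative of a row of the solution -/

section RowEquation

variable {N : ℕ} {t s : ℝ} {H : Fin N → Fin N → ℝ × ℝ → ℂ} {M B : ℝ → ℝ}

theorem boundedRow_entries (s : ℝ) (k : RowSpace N) : BoundedRow s (fun l q => k q l) ‖k‖ :=
  ⟨fun l => (continuous_row_entry k l).continuousOn, fun l q _ => norm_row_entry_le k q l⟩

namespace TameKernel

theorem kernelOp_zero_apply (h : TameKernel t H M B) (hts : t ≤ s) (k : RowSpace N) (s' : ℝ)
    (j : Fin N) :
    kernelOp H s 0 k s' j = ∫ q in Ioi s, ∑ l, k q l * H l j (q, max s' s) := by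
  simpa using h.kernelOp_apply (le_sub_zero hts) k s' j

theorem kernelOp_zero_smul (h : TameKernel t H M B) (hts : t ≤ s) (c : ℂ) (k : RowSpace N) :
    kernelOp H s 0 (c • k) = c • kernelOp H s 0 k := by
  ext s' j
  rw [BoundedContinuousFunction.smul_apply, Pi.smul_apply, h.kernelOp_zero_apply hts,
    h.kernelOp_zero_apply hts, smul_eq_mul, ← integral_const_mul]
  simp [Finset.mul_sum, mul_assoc]

theorem rowTransform_eq_apply (h : TameKernel t H M B) (hts : t ≤ s) {i : Fin N}
    {k : RowSpace N} (s' : ℝ) (j : Fin N) :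
    (kernelRow H s i s 0 + kernelOp H s 0 k) s' j
      = rowTransform H s i (fun l q => k q l) j (max s' s) := by
  rw [BoundedContinuousFunction.add_apply, Pi.add_apply, h.kernelRow_zero_apply hts hts,
    h.kernelOp_zero_apply hts, rowTransform]

end TameKernel

/-- Integration by parts: for a solution `k` of the `i`-th row equation,
`∫ k_m(q) ∂₁H_mj(q, y) dq + ∫ k_m'(q) H_mj(q, y) dq = -k_m(s) H_mj(s, y)`. -/
theorem DecayingKernel.integral_mul_dFst_add (h : DecayingKernel 2 t H M B) (hts : t < s)
    {i : Fin N} {κ : Fin N → ℝ → ℂ} {C : ℝ} (hκ : BoundedRow s κ C) (m j : Fin N)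
    (hκm : ∀ q ≥ s, rowTransform H s i κ m q = κ m q) {y : ℝ} (hy : t ≤ y) :
    IntegrableOn (fun q => rowTransform (dSnd H) s i κ m q * H m j (q, y)) (Ioi s) ∧
    (∫ q in Ioi s, κ m q * dFst H m j (q, y))
      + ∫ q in Ioi s, rowTransform (dSnd H) s i κ m q * H m j (q, y)
      = -(κ m s * H m j (s, y)) := by
  have h1 : DominatedKernel t (dFst H) M B :=
    { toDecayBounds := h.toDecayBounds
      continuousOn := h.tame_dFst.continuousOn
      norm_le := h.tame_dFst.norm_le }
  have h2 := h.dominated_dSnd one_le_two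
  have hM : IntegrableOn M (Ioi s) :=
    h.integrable_left.mono_set fun q hq => hts.le.trans (le_of_lt hq)
  have hint0 := h.dominated.integrableOn_mul hts.le hκ m j hy
  have hint1 := h1.integrableOn_mul hts.le hκ m j hy
  have hint2 : IntegrableOn (fun q => rowTransform (dSnd H) s i κ m q * H m j (q, y))
      (Ioi s) := by
    set D := M s + ∑ _l : Fin N, C * ∫ q in Ioi s, M q
    have hDn : 0 ≤ D := add_nonneg (h.nonneg_left s hts.le) (Finset.sum_nonneg fun l _ =>
      mul_nonneg (hκ.nonneg l) (setIntegral_nonneg measurableSet_Ioi fun q hq =>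
        h.nonneg_left q (hts.le.trans (le_of_lt hq))))
    refine Integrable.mono' ((hM.mul_const (B y)).const_mul (D * B s)) ?_ ?_
    · refine (h.aestronglyMeasurable_rowTransform_dSnd one_le_two hts.le hκ i m).mul ?_
      exact ((h.dominated.continuousOn_left m j hy).mono fun q hq =>
        hts.le.trans (le_of_lt hq)).aestronglyMeasurable measurableSet_Ioi
    · refine (ae_restrict_iff' measurableSet_Ioi).2 (Eventually.of_forall fun q hq => ?_)
      have hqt := hts.le.trans (le_of_lt hq)
      rw [norm_mul]
      refine mul_le_mul ((h2.norm_rowTransform_le hts.le hκ i m hqt).trans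
        (mul_le_mul_of_nonneg_left (h.anti_right hts.le hqt (le_of_lt hq)) hDn))
        (h.norm_le m j hqt hy) (norm_nonneg _)
        (mul_nonneg hDn (h.nonneg_right s hts.le))
  refine ⟨hint2, ?_⟩
  have hderiv : ∀ q ∈ Ici s, HasDerivAt (fun q => rowTransform H s i κ m q * H m j (q, y))
      (rowTransform (dSnd H) s i κ m q * H m j (q, y)
        + rowTransform H s i κ m q * dFst H m j (q, y)) q := fun q hq =>
    (h.hasDerivAt_rowTransform one_le_two hts.le hκ i m (hts.trans_le hq)).mul
      (h.hasDerivAt_fst one_le_two m j (hts.le.trans hq) hy)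
  have hint0' : IntegrableOn (fun q => rowTransform H s i κ m q * H m j (q, y)) (Ioi s) :=
    hint0.congr_fun (fun q hq => by simp only [hκm q (le_of_lt hq)]) measurableSet_Ioi
  have hint1' : IntegrableOn (fun q => rowTransform H s i κ m q * dFst H m j (q, y)) (Ioi s) :=
    hint1.congr_fun (fun q hq => by simp only [hκm q (le_of_lt hq)]) measurableSet_Ioi
  -- The product and its derivative are both integrable, so the product tends to 0 at infinity.
  have key := integral_Ioi_of_hasDerivAt_of_tendsto' hderiv (Integrable.add hint2 hint1')
    (tendsto_zero_of_hasDerivAt_of_integrableOn_Ioi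
      (fun q hq => hderiv q (mem_Ici_of_Ioi hq)) (Integrable.add hint2 hint1') hint0')
  rw [integral_add hint2 hint1', hκm s le_rfl, zero_sub] at key
  rw [← key, add_comm]
  congr 1
  exact setIntegral_congr_fun measurableSet_Ioi fun q hq => by simp only [hκm q (le_of_lt hq)]

/-- The `u`-derivatives of the rows of the solution of the integral equation. -/
theorem DecayingKernel.fderiv_row_apply (h : DecayingKernel 2 t H M B) (hts : t < s)
    {k : (Fin N → ℝ) → Fin N → RowSpace N}
    (hk : ∀ i, ∀ᶠ v in 𝓝 0, k v i = kernelRow H s i (s - v i) v + kernelOp H s v (k v i))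
    (hinj : ∀ r, r = kernelOp H s 0 r → r = 0) (i : Fin N) :
    DifferentiableAt ℝ (fun v => k v i) 0 ∧ ∀ m, m ≠ i → ∀ j,
      fderiv ℝ (fun v => k v i) 0 (Pi.single m 1) s j
        = k 0 i s m * k 0 m s j
          - if j = m then rowTransform (dSnd H) s i (fun l q => k 0 i q l) m s else 0 := by
  have hH := h.tame one_le_two
  have h2 := h.tame_dSnd
  have hcpt : IsCompactOperator (kernelOp H s (0 : Fin N → ℝ)) :=
    hH.kernelOp_isCompactOperator (TameKernel.le_sub_zero hts.le)
  have hunit := hcpt.isUnit_one_sub hinj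
  have hA := h.hasFDerivAt_kernelOp hts
  have hg := h.hasFDerivAt_kernelRow hts i
  refine ⟨differentiableAt_of_eq_add_clm_apply hA.differentiableAt hg.differentiableAt hunit
    (hk i), fun m hm j => ?_⟩
  have hk0 : ∀ i, k 0 i = kernelRow H s i s 0 + kernelOp H s 0 (k 0 i) := fun i => by
    simpa using (hk i).self_of_nhds
  set D := fderiv ℝ (fun v => k v i) 0 (Pi.single m 1) with hD
  -- Because m ≠ i, the inhomogeneous row contributes no derivative in its first argument.
  have hDeq := fderiv_apply_of_eq_add_clm_apply hA hg hunit (hk i) (Pi.single m 1)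
  rw [← hD, kernelRowDeriv_single, kernelOpDeriv_single, if_neg hm, zero_add,
    kernelOpPartial] at hDeq
  set κ : Fin N → ℝ → ℂ := fun l q => k 0 i q l with hκdef
  have hκ : BoundedRow s κ ‖k 0 i‖ := boundedRow_entries s (k 0 i)
  have hκm : ∀ q ≥ s, rowTransform H s i κ m q = κ m q := fun q hq => by
    have := hH.rowTransform_eq_apply hts.le (i := i) (k := k 0 i) q m
    rw [← hk0, max_eq_left hq] at this
    exact this.symm
  set P := rowIntegral N s m (fun q => kernelRow (dFst H) s m q 0) with hP
  -- Up to sign, L collects all terms where the derivative falls on the second argument. Its only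
  -- nonzero column is the m-th, which on [s, ∞) is the s'-derivative of the m-th entry of the row.
  set L : RowSpace N := kernelRow (onlyColumn m (dSnd H)) s i s 0
    + (∑ l, rowIntegral N s l (fun q => kernelRow (onlyColumn m (dSnd H)) s l q 0)) (k 0 i)
    with hL
  have hLapp : ∀ s' j, L s' j
      = if j = m then rowTransform (dSnd H) s i κ m (max s' s) else 0 := fun s' j => by
    have h3 := (h2.onlyColumn m).rowTransform_eq_apply hts.le (i := i) (k := k 0 i) s' j
    simp only [kernelOp, Pi.zero_apply, sub_zero] at h3
    rw [hL, h3]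
    unfold rowTransform onlyColumn
    by_cases hj : j = m
    · simp [hj, hκdef]
    · simp [hj]
  have hparts : P (k 0 i) + kernelOp H s 0 L = -(k 0 i s m • kernelRow H s m s 0) := by
    ext s' j
    obtain ⟨hi2, hp⟩ := h.integral_mul_dFst_add hts hκ m j hκm (hts.le.trans (le_max_right s' s))
    have e1 := (h.tame_dFst.rowIntegral_kernelRow_apply (TameKernel.le_sub_zero hts.le) m m
      (k 0 i) s' j).2
    simp only [Pi.zero_apply, sub_zero] at e1
    rw [BoundedContinuousFunction.add_apply, Pi.add_apply, hP, e1, hH.kernelOp_zero_apply hts.le,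
      BoundedContinuousFunction.neg_apply, Pi.neg_apply, BoundedContinuousFunction.smul_apply,
      Pi.smul_apply, hH.kernelRow_zero_apply hts.le hts.le, smul_eq_mul]
    refine Eq.trans ?_ hp
    congr 1
    refine setIntegral_congr_fun measurableSet_Ioi fun q hq => ?_
    simp only [hLapp, ite_mul, zero_mul, Finset.sum_ite_eq', Finset.mem_univ, if_true]
    rw [max_eq_left (le_of_lt (mem_Ioi.1 hq))]
  have hDL : D = -L - P (k 0 i) + kernelOp H s 0 D := by
    conv_lhs => rw [hDeq]
    simp only [neg_apply, add_apply, hL]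
    abel
  -- Substituting the integration by parts and the m-th row equation shows that this combination is
  -- fixed by the operator; injectivity then kills it.
  have hzero : D + L - k 0 i s m • k 0 m = 0 := by
    refine hinj _ ?_
    rw [map_sub, map_add, hH.kernelOp_zero_smul hts.le]
    have e1 : kernelOp H s 0 L = -(k 0 i s m • kernelRow H s m s 0) - P (k 0 i) := by
      rw [← hparts]; abel
    have e2 : k 0 i s m • k 0 m = k 0 i s m • kernelRow H s m s 0
        + k 0 i s m • kernelOp H s 0 (k 0 m) := by
      conv_lhs => rw [hk0 m]
      ext s' j
      exact mul_add _ _ _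
    rw [e1]
    conv_lhs => rw [hDL, e2]
    abel
  have hDfin : D = k 0 i s m • k 0 m - L := by
    rw [← sub_eq_zero, ← hzero]; abel
  rw [hDfin, BoundedContinuousFunction.sub_apply, Pi.sub_apply, hLapp, max_self]
  rfl

end RowEquation

/-! ### From the decay hypotheses to a single dominated kernel -/

section Shift

/-- A negative value would bound all later values from above, making a nonzero constant integrable
on a half-line. -/
theorem AntitoneOn.nonneg_of_integrableOn_Ici {m : ℝ → ℝ} {a : ℝ} (hm : AntitoneOn m (Ici a))
    (hi : IntegrableOn m (Ici a)) {x : ℝ} (hx : a ≤ x) : 0 ≤ m x := by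
  by_contra! hneg
  have hi' : IntegrableOn m (Ici x) := hi.mono_set (Ici_subset_Ici.2 hx)
  have hc : IntegrableOn (fun _ => m x) (Ici x) := by
    refine Integrable.mono hi' aestronglyMeasurable_const
      ((ae_restrict_iff' measurableSet_Ici).2 (Eventually.of_forall fun y hy => ?_))
    have hyx : m y ≤ m x := hm hx (hx.trans hy) hy
    rw [Real.norm_of_nonpos hneg.le, Real.norm_of_nonpos (hyx.trans hneg.le)]
    linarith
  rw [integrableOn_const_iff] at hc
  rcases hc with h | h
  · simp [hneg.ne] at h
  · simp at h

/-- The gap between t and s is the room in which u can be varied and two-sided derivatives taken at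
s. -/
theorem exists_lt_forall_sub_mem {N : ℕ} {J : Fin N → Set ℝ} (hJ : ∀ i, IsOpen (J i)) {s : ℝ}
    {u : Fin N → ℝ} (hu : ∀ i, u i - s ∈ J i) : ∃ t < s, ∀ i, u i - t ∈ J i := by
  have : ∀ᶠ t in 𝓝 s, ∀ i, u i - t ∈ J i := by
    refine eventually_all.2 fun i => ?_
    have hc : ContinuousAt (fun t => u i - t) s := by fun_prop
    exact hc.eventually ((hJ i).mem_nhds (hu i))
  obtain ⟨t, ht, hts⟩ := ((this.filter_mono nhdsWithin_le_nhds).and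
    (self_mem_nhdsWithin : Iio s ∈ 𝓝[<] s)).exists
  exact ⟨t, hts, ht⟩

variable {N : ℕ} {J : Fin N → Set ℝ}

theorem isOpen_quadrant {A B : Set ℝ} (hA : IsOpen A) (hB : IsOpen B) : IsOpen (quadrant A B) :=
  (hA.preimage continuous_fst.neg).inter (hB.preimage continuous_snd.neg)

theorem exists_decayingKernel_of_decays (hJ_open : ∀ i, IsOpen (J i))
    (hJ_lower : ∀ i, IsLowerSet (J i)) {n : ℕ} {H : Fin N → Fin N → ℝ × ℝ → ℂ}
    (hH : ∀ i j, Decays n (J i) (J j) (H i j)) {t : ℝ} {u : Fin N → ℝ}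
    (ht : ∀ i, u i - t ∈ J i) :
    ∃ M B, DecayingKernel n t (fun i j p => H i j (p - (u i, u j))) M B := by
  have ht' : ∀ i, -(t - u i) ∈ J i := fun i => by simpa using ht i
  choose m b hm hmi hb hbi hbd using fun i j => (hH i j).2 (t - u i) (t - u j) (ht' i) (ht' j)
  have hsub : ∀ {x : ℝ} (i : Fin N), t ≤ x → t - u i ≤ x - u i := fun i hx =>
    sub_le_sub_right hx _
  have hmn : ∀ i j, ∀ x ≥ t, 0 ≤ m i j (x - u i) := fun i j x hx =>
    (hm i j).nonneg_of_integrableOn_Ici (hmi i j) (hsub i hx)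
  have hbn : ∀ i j, ∀ x ≥ t, 0 ≤ b i j (x - u j) := fun i j x hx =>
    (hb i j).nonneg_of_integrableOn_Ici (hbi i j) (hsub j hx)
  have hshift : ∀ {g : ℝ → ℝ} {c : ℝ}, IntegrableOn g (Ici (t - c)) →
      IntegrableOn (fun x => g (x - c)) (Ici t) := fun {g c} hg => by
    have := (measurePreserving_sub_right (volume : Measure ℝ) c).integrableOn_comp_preimage
      (measurableEmbedding_subRight c) (f := g) (s := Ici (t - c))
    simpa [Function.comp_def] using this.2 hg
  -- Summing the nonnegative bounds over all index pairs gives one product that dominates every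
  -- entry.
  refine ⟨fun x => ∑ i, ∑ j, m i j (x - u i), fun x => ∑ i, ∑ j, b i j (x - u j),
    ⟨?_, ?_, ?_, ?_, ?_, ?_⟩, ?_, ?_⟩
  · exact fun x hx => Finset.sum_nonneg fun i _ => Finset.sum_nonneg fun j _ => hmn i j x hx
  · exact fun x hx => Finset.sum_nonneg fun i _ => Finset.sum_nonneg fun j _ => hbn i j x hx
  · exact fun x hx y hy hxy => Finset.sum_le_sum fun i _ => Finset.sum_le_sum fun j _ =>
      hm i j (hsub i hx) (hsub i hy) (sub_le_sub_right hxy _)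
  · exact fun x hx y hy hxy => Finset.sum_le_sum fun i _ => Finset.sum_le_sum fun j _ =>
      hb i j (hsub j hx) (hsub j hy) (sub_le_sub_right hxy _)
  · exact integrable_finsetSum _ fun i _ => integrable_finsetSum _ fun j _ => hshift (hmi i j)
  · exact integrable_finsetSum _ fun i _ => integrable_finsetSum _ fun j _ => hshift (hbi i j)
  · intro i j x hx y hy
    have hmem : ((x, y) - (u i, u j) : ℝ × ℝ) ∈ quadrant (J i) (J j) :=
      ⟨hJ_lower i (neg_le_neg (hsub i hx)) (ht' i), hJ_lower j (neg_le_neg (hsub j hy)) (ht' j)⟩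
    have h1 := (hH i j).1.contDiffAt
      ((isOpen_quadrant (hJ_open i) (hJ_open j)).mem_nhds hmem)
    exact ContDiffAt.comp (g := H i j) (f := fun p : ℝ × ℝ => p - (u i, u j)) (x, y) h1
      (contDiffAt_id.sub contDiffAt_const)
  · intro i j k hk x hx y hy
    rw [iteratedFDeriv_comp_sub]
    refine (hbd i j k hk (x - u i) (hsub i hx) (y - u j) (hsub j hy)).trans ?_
    have h1 : m i j (x - u i) ≤ ∑ i, ∑ j, m i j (x - u i) :=
      (Finset.single_le_sum (f := fun j => m i j (x - u i)) (fun j _ => hmn i j x hx)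
        (Finset.mem_univ j)).trans
        (Finset.single_le_sum (f := fun i => ∑ j, m i j (x - u i))
          (fun i _ => Finset.sum_nonneg fun j _ => hmn i j x hx) (Finset.mem_univ i))
    have h2 : b i j (y - u j) ≤ ∑ i, ∑ j, b i j (y - u j) :=
      (Finset.single_le_sum (f := fun j => b i j (y - u j)) (fun j _ => hbn i j y hy)
        (Finset.mem_univ j)).trans
        (Finset.single_le_sum (f := fun i => ∑ j, b i j (y - u j))
          (fun i _ => Finset.sum_nonneg fun j _ => hbn i j y hy) (Finset.mem_univ i))
    exact mul_le_mul h1 h2 (hbn i j y hy) ((hmn i j x hx).trans h1)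

end Shift

/-! ### Coordinate derivatives in u -/

section PartialDerivative

variable {N : ℕ}

theorem hasDerivAt_comp_update {φ : (Fin N → ℝ) → ℂ} {u : Fin N → ℝ}
    (h : DifferentiableAt ℝ φ u) (k : Fin N) :
    HasDerivAt (fun x => φ (Function.update u k x)) (fderiv ℝ φ u (Pi.single k 1)) (u k) := by
  have h1 : HasFDerivAt φ (fderiv ℝ φ u) (Function.update u k (u k)) := by
    rw [Function.update_eq_self]; exact h.hasFDerivAt
  exact h1.comp_hasDerivAt (u k) (hasDerivAt_update u k (u k))

theorem pd_eq_fderiv {φ : (Fin N → ℝ) → ℂ} {u : Fin N → ℝ} (h : DifferentiableAt ℝ φ u)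
    (k : Fin N) : pd k φ u = fderiv ℝ φ u (Pi.single k 1) :=
  (hasDerivAt_comp_update h k).deriv

theorem pd_coord_mul {φ : (Fin N → ℝ) → ℂ} {u : Fin N → ℝ} (h : DifferentiableAt ℝ φ u)
    (k : Fin N) {g : ℝ → ℂ} {g' : ℂ} (hg : HasDerivAt g g' (u k)) :
    pd k (fun w => g (w k) * φ w) u = g' * φ u + g (u k) * pd k φ u := by
  have := hg.mul (hasDerivAt_comp_update h k)
  rw [Function.update_eq_self] at this
  rw [pd_eq_fderiv h, pd]
  simp only [Function.update_self]
  exact this.deriv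

theorem sum_eq_add_add_sum_ne {M : Type*} [AddCommGroup M] (g : Fin N → M) {i j : Fin N}
    (hij : i ≠ j) : ∑ l, g l = g i + g j + ∑ l with l ≠ i ∧ l ≠ j, g l := by
  have : (Finset.univ.filter fun l => l ≠ i ∧ l ≠ j) = (Finset.univ.erase i).erase j := by
    ext l; simp [and_comm]
  rw [this, add_assoc, Finset.add_sum_erase _ _ (by simp [hij.symm]),
    Finset.add_sum_erase _ _ (Finset.mem_univ i)]

end PartialDerivative

/-! ### The integral equation as an equation in the row space -/

section GLM

variable {N : ℕ} {t s : ℝ}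

/-- The rows of the solution `K` at `u + v`, extended to `s' ≤ s` by constants. -/
def solutionRow (K : Fin N → Fin N → ℝ → ℝ → (Fin N → ℝ) → ℂ) (s : ℝ) (u v : Fin N → ℝ)
    (i : Fin N) : RowSpace N :=
  toBounded fun s' j => K i j s (max s' s) (u + v)

variable {F : Fin N → Fin N → ℝ → ℝ → ℂ} {K : Fin N → Fin N → ℝ → ℝ → (Fin N → ℝ) → ℂ}
  {u : Fin N → ℝ} {M B : ℝ → ℝ}

/-- The kernel `F_ij(x - uⁱ, y - uʲ)` as a function of `(x, y)`. -/
def shiftedKernel (F : Fin N → Fin N → ℝ → ℝ → ℂ) (u : Fin N → ℝ) (i j : Fin N)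
    (p : ℝ × ℝ) : ℂ :=
  F i j (p.1 - u i) (p.2 - u j)

theorem IsGLMSolution.solutionRow_apply {𝓕 : Fin N → Fin N → ℝ → ℝ → ℂ} {v : Fin N → ℝ}
    (h : IsGLMSolution 𝓕 s (fun i j s' => K i j s s' (u + v))) (i j : Fin N) (s' : ℝ) :
    solutionRow K s u v i s' j = K i j s (max s' s) (u + v) := by
  obtain ⟨C, hC⟩ := h.bounded
  rw [solutionRow, toBounded_apply (C := max C 0)]
  · exact continuous_pi fun j => (h.continuousOn i j).comp_continuous (by fun_prop)
      fun s' => mem_Ici.2 (le_max_right _ _)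
  · exact fun s' => (pi_norm_le_iff_of_nonneg (le_max_right _ _)).2 fun j =>
      (hC i j _ (le_max_right _ _)).trans (le_max_left _ _)

theorem solutionRow_eq (h : TameKernel t (shiftedKernel F u) M B) {v : Fin N → ℝ}
    (hv : ∀ j, t ≤ s - v j)
    (hsol : IsGLMSolution (fun i j q q' => dressing F i j q q' (u + v)) s
      (fun i j s' => K i j s s' (u + v))) (i : Fin N) :
    solutionRow K s u v i = kernelRow (shiftedKernel F u) s i (s - v i) v
      + kernelOp (shiftedKernel F u) s v (solutionRow K s u v i) := by
  ext s' j
  have hshift : ∀ l j x y, shiftedKernel F u l j (x - v l, y - v j)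
      = dressing F l j x y (u + v) := fun l j x y => by
    simp only [shiftedKernel, dressing, Pi.add_apply, sub_sub, add_comm]
  rw [BoundedContinuousFunction.add_apply, Pi.add_apply, h.kernelRow_apply hv (hv i),
    h.kernelOp_apply hv, hshift, hsol.solutionRow_apply,
    hsol.equation i j _ (le_max_right s' s)]
  congr 1
  refine setIntegral_congr_fun measurableSet_Ioi fun q hq => ?_
  simp only [hshift, hsol.solutionRow_apply, max_eq_left (le_of_lt (mem_Ioi.1 hq))]

/-- Adding a solution k of the homogeneous equation to every row of K gives another bounded
continuous solution, so uniqueness forces k = 0 on [s, ∞). -/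
theorem eq_zero_of_eq_kernelOp (h : TameKernel t (shiftedKernel F u) M B) (hts : t ≤ s)
    (huniq : IsUniqueGLMSolution (fun i j q q' => dressing F i j q q' u) s
      (fun i j s' => K i j s s' u)) (k : RowSpace N)
    (hk : k = kernelOp (shiftedKernel F u) s 0 k) : k = 0 := by
  have happ : ∀ s' j, k s' j = ∫ q in Ioi s, ∑ l, k q l * dressing F l j q (max s' s) u :=
    fun s' j => by
      conv_lhs => rw [hk]
      rw [h.kernelOp_zero_apply hts]
      rfl
  -- A fixed point is constant to the left of s, so its vanishing on [s, ∞) is enough.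
  have hclip : ∀ s' j, k s' j = k (max s' s) j := fun s' j => by
    rw [happ s', happ (max s' s), max_eq_left (le_max_right s' s)]
  obtain ⟨hsol, hun⟩ := huniq
  have hu0 : u + 0 = u := add_zero u
  have hint : ∀ (r : RowSpace N) l j y, s ≤ y →
      IntegrableOn (fun q => r q l * dressing F l j q y u) (Ioi s) := fun r l j y hy => by
    have := (h.rowIntegral_kernelRow_apply (TameKernel.le_sub_zero hts) l l r y j).1
    simpa [max_eq_left hy, shiftedKernel, dressing] using this
  have hsol0 : IsGLMSolution (fun i j q q' => dressing F i j q q' u) s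
      (fun i j s' => K i j s s' (u + 0)) := by rwa [hu0]
  have hintK : ∀ i l j y, s ≤ y →
      IntegrableOn (fun q => K i l s q u * dressing F l j q y u) (Ioi s) := fun i l j y hy => by
    refine (hint (solutionRow K s u 0 i) l j y hy).congr_fun (fun q hq => ?_) measurableSet_Ioi
    simp only [hsol0.solutionRow_apply, hu0, max_eq_left (le_of_lt (mem_Ioi.1 hq))]
  have hnew : IsGLMSolution (fun i j q q' => dressing F i j q q' u) s
      (fun i j s' => K i j s s' u + k s' j) := by
    refine ⟨fun i j => (hsol.continuousOn i j).add (continuous_row_entry k j).continuousOn,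
      ?_, fun i j s' hs' => ?_⟩
    · obtain ⟨C, hC⟩ := hsol.bounded
      exact ⟨C + ‖k‖, fun i j s' hs' =>
        norm_add_le_of_le (hC i j s' hs') (norm_row_entry_le k s' j)⟩
    · have e1 : K i j s s' u = _ := hsol.equation i j s' hs'
      have e2 := happ s' j
      rw [max_eq_left hs'] at e2
      rw [e1, e2, add_assoc, ← integral_add
        (integrable_finsetSum _ fun l _ => hintK i l j s' hs')
        (integrable_finsetSum _ fun l _ => hint k l j s' hs')]
      simp only [add_mul, Finset.sum_add_distrib]
  ext s' j
  have := hun _ hnew j j (max s' s) (le_max_right _ _)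
  rw [hclip]
  simpa using this

end GLM

/-! ### The Lamé equations and their weighted reduction -/

section Lame

variable {N : ℕ} {J : Fin N → Set ℝ}

theorem rowTransform_mul_weight {H : Fin N → Fin N → ℝ × ℝ → ℂ} {s : ℝ} (ρ : Fin N → ℝ → ℂ)
    (i : Fin N) (κ : Fin N → ℝ → ℂ) (j : Fin N) (y : ℝ) :
    rowTransform (fun i j p => H i j p * ρ j p.2) s i κ j y
      = rowTransform H s i κ j y * ρ j y := by
  simp only [rowTransform, add_mul, ← integral_mul_const, Finset.sum_mul, mul_assoc]

/-- Stated for an arbitrary differentiable nonvanishing weight r, so that the weights 1 and √f yield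
the second and third relations by one argument. -/
theorem dressing_lame (hJ_open : ∀ i, IsOpen (J i)) (hJ_lower : ∀ i, IsLowerSet (J i))
    {r : Fin N → ℝ → ℂ} (hr : ∀ i, ∀ x ∈ J i, DifferentiableAt ℝ (r i) x)
    (hr_ne : ∀ i, ∀ x ∈ J i, r i x ≠ 0) {F : Fin N → Fin N → ℝ → ℝ → ℂ}
    (hF : ∀ i j, Decays 2 (J i) (J j) (fun p => F i j p.1 p.2))
    (hFr : ∀ i j, Decays 1 (J i) (J j) (fun p => F i j p.1 p.2 * r j (-p.2)))
    (hZ : ZakharovRelation J (rescaledDressing r F))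
    {W : Set (ℝ × (Fin N → ℝ))} {K : Fin N → Fin N → ℝ → ℝ → (Fin N → ℝ) → ℂ}
    (hW : IsOpen W) (hWJ : ∀ s u, (s, u) ∈ W → ∀ i, u i - s ∈ J i)
    (hK : ∀ s u, (s, u) ∈ W →
      IsUniqueGLMSolution (fun i j q q' => dressing F i j q q' u) s
        (fun i j s' => K i j s s' u))
    {s : ℝ} {u : Fin N → ℝ} (hsu : (s, u) ∈ W) :
    (∀ i j, DifferentiableAt ℝ (rotationCoeff K s i j) u) ∧
      Lame1 (rotationCoeff K s) u ∧
      Lame3 (fun i x => r i (x - s) ^ 2) (fun i x => r i (x - s)) (rotationCoeff K s) u := by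
  obtain ⟨t, hts, ht⟩ := exists_lt_forall_sub_mem hJ_open (hWJ s u hsu)
  obtain ⟨M, B, hH⟩ := exists_decayingKernel_of_decays hJ_open hJ_lower hF ht
  obtain ⟨M', B', hHr⟩ := exists_decayingKernel_of_decays hJ_open hJ_lower hFr ht
  set ρ : Fin N → ℝ → ℂ := fun j q => r j (u j - q) with hρ
  set H := shiftedKernel F u with hHdef
  replace hH : DecayingKernel 2 t H M B := hH
  replace hHr : DecayingKernel 1 t (fun i j p => H i j p * ρ j p.2) M' B' := by
    simpa [hHdef, shiftedKernel, hρ] using hHr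
  have hJt : ∀ i q, t ≤ q → u i - q ∈ J i := fun i q hq =>
    hJ_lower i (sub_le_sub_left hq _) (ht i)
  have hWv : ∀ᶠ v in 𝓝 (0 : Fin N → ℝ), (s, u + v) ∈ W := by
    have hc : ContinuousAt (fun v : Fin N → ℝ => (s, u + v)) 0 := by fun_prop
    exact hc.eventually (hW.mem_nhds (by simpa using hsu))
  have htv : ∀ᶠ v in 𝓝 (0 : Fin N → ℝ), ∀ j, t ≤ s - v j := by
    refine eventually_all.2 fun j => ?_
    have hc : ContinuousAt (fun v : Fin N → ℝ => s - v j) 0 :=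
      (continuous_const.sub (continuous_apply j)).continuousAt
    exact (hc.eventually (lt_mem_nhds (by simpa using hts))).mono fun _ h => h.le
  set k := solutionRow K s u with hkdef
  have hkapp : ∀ᶠ v in 𝓝 (0 : Fin N → ℝ), ∀ i s' j,
      k v i s' j = K i j s (max s' s) (u + v) := hWv.mono fun v hv i s' j =>
    (hK s _ hv).1.solutionRow_apply i j s'
  have hkeq : ∀ i, ∀ᶠ v in 𝓝 0, k v i = kernelRow H s i (s - v i) v + kernelOp H s v (k v i) :=
    fun i => by
      filter_upwards [hWv, htv] with v hv hv'
      exact solutionRow_eq (hH.tame one_le_two) hv' (hK s _ hv).1 i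
  have hinj := eq_zero_of_eq_kernelOp (hH.tame one_le_two) hts.le (hK s u hsu)
  have hrow := hH.fderiv_row_apply hts hkeq hinj
  have hβ : ∀ i j, HasFDerivAt (rotationCoeff K s i j)
      (((ContinuousLinearMap.proj (R := ℝ) (φ := fun _ : Fin N => ℂ) i).comp
        (BoundedContinuousFunction.evalCLM ℝ s)).comp (fderiv ℝ (fun v => k v j) 0)) u := by
    intro i j
    let ev : RowSpace N →L[ℝ] ℂ :=
      (ContinuousLinearMap.proj (R := ℝ) (φ := fun _ : Fin N => ℂ) i).comp
        (BoundedContinuousFunction.evalCLM ℝ s)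
    have h1 : HasFDerivAt (fun v => ev (k v j)) (ev.comp (fderiv ℝ (fun v => k v j) 0)) 0 :=
      ev.hasFDerivAt.comp 0 (hrow j).1.hasFDerivAt
    have h2 : HasFDerivAt (fun v => rotationCoeff K s i j (u + v))
        (ev.comp (fderiv ℝ (fun v => k v j) 0)) 0 := by
      refine h1.congr_of_eventuallyEq (hkapp.mono fun v hv => ?_)
      change K j i s s (u + v) = k v j s i
      rw [hv, max_self]
    have h3 : HasFDerivAt (fun w : Fin N → ℝ => w - u) (ContinuousLinearMap.id ℝ _) u :=
      (hasFDerivAt_id u).sub_const u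
    have h4 := HasFDerivAt.comp (g := fun v => rotationCoeff K s i j (u + v)) u
      (by simpa using h2) h3
    simpa [Function.comp_def] using h4
  have hk0 : ∀ i j, k 0 i s j = K i j s s u := fun i j => by
    have := hkapp.self_of_nhds i s j
    rwa [max_self, add_zero] at this
  have hpd : ∀ i j m, m ≠ j → pd m (rotationCoeff K s i j) u
      = K j m s s u * K m i s s u
        - if i = m then rowTransform (dSnd H) s j (fun l q => k 0 j q l) m s else 0 := by
    intro i j m hm
    rw [pd_eq_fderiv (hβ i j).differentiableAt, (hβ i j).fderiv, ← hk0, ← hk0]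
    exact (hrow j).2 m hm i
  refine ⟨fun i j => (hβ i j).differentiableAt, fun i j m _ him hjm => ?_, fun i j hij => ?_⟩
  · rw [hpd i j m hjm.symm, if_neg him, sub_zero, mul_comm]
    rfl
  set T : Fin N → Fin N → ℂ := fun i j => rowTransform (dSnd H) s i (fun l q => k 0 i q l) j s
    with hT
  have hρc : ∀ l, ∀ q ≥ t, HasDerivAt (ρ l) (-deriv (r l) (u l - q)) q := fun l q hq => by
    have h1 : HasDerivAt (fun q => u l - q) (-1) q := by
      simpa using (hasDerivAt_id q).const_sub (u l)
    have h2 := (hr l _ (hJt l q hq)).hasDerivAt.scomp q h1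
    rw [neg_one_smul] at h2
    exact h2
  -- The factor 1/ρ of the rescaled kernel is constant in the variable being differentiated;
  -- multiplying the Zakharov relation by both weights gives skew symmetry.
  have hskew : ∀ l j, ∀ p ≥ s, ∀ q ≥ s,
      dSnd (fun i j p => H i j p * ρ j p.2) l j (p, q) * ρ j q
        = -(dSnd (fun i j p => H i j p * ρ j p.2) j l (q, p) * ρ l p) := fun l j p hp q hq => by
    have hp' := hts.le.trans hp
    have hq' := hts.le.trans hq
    have hz := hZ l j u p q (hJt l p hp') (hJt j q hq')
    have hd : ∀ l j p q, t ≤ p → t ≤ q →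
        deriv (fun q => rescaledDressing r F l j p q u) q
          = dSnd (fun i j p => H i j p * ρ j p.2) l j (p, q) / ρ l p := fun l j p q hp hq => by
      have := (hHr.hasDerivAt_snd le_rfl l j hp hq).div_const (ρ l p)
      rw [← this.deriv]
      congr 1
      funext q
      simp only [rescaledDressing, hHdef, shiftedKernel, hρ]
      ring
    rw [hd l j p q hp' hq', hd j l q p hq' hp'] at hz
    have n1 : ρ l p ≠ 0 := hr_ne l _ (hJt l p hp')
    have n2 : ρ j q ≠ 0 := hr_ne j _ (hJt j q hq')
    field_simp at hz
    linear_combination hz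
  set C := ‖k 0 i‖ ⊔ ‖k 0 j‖
  have hκ : BoundedRow s (fun l q => k 0 i q l) C :=
    ⟨(boundedRow_entries s _).continuousOn, fun l q hq =>
      ((boundedRow_entries s _).norm_le l q hq).trans le_sup_left⟩
  have hκ' : BoundedRow s (fun l q => k 0 j q l) C :=
    ⟨(boundedRow_entries s _).continuousOn, fun l q hq =>
      ((boundedRow_entries s _).norm_le l q hq).trans le_sup_right⟩
  have hsolw : ∀ i l, ∀ q ≥ s,
      rowTransform (fun i j p => H i j p * ρ j p.2) s i (fun l q => k 0 i q l) l q
        = k 0 i q l * ρ l q := fun i l q hq => by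
    have h1 := (hH.tame one_le_two).rowTransform_eq_apply hts.le (i := i) (k := k 0 i) q l
    have h2 : k 0 i = kernelRow H s i s 0 + kernelOp H s 0 (k 0 i) := by
      simpa using (hkeq i).self_of_nhds
    rw [← h2, max_eq_left hq] at h1
    rw [rowTransform_mul_weight, ← h1]
  -- Two computations of the derivative of the weighted row are compared. The term with the
  -- derivative of r later matches the product rule for ∂(r_i β_ij)/∂u^i.
  have hTw : ∀ {i j : Fin N}, BoundedRow s (fun l q => k 0 i q l) C →
      rowTransform (dSnd fun i j p => H i j p * ρ j p.2) s i (fun l q => k 0 i q l) j s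
        = T i j * ρ j s - deriv (r j) (u j - s) * K i j s s u := fun {i j} hκ => by
    have h1 := hHr.hasDerivAt_rowTransform le_rfl hts.le hκ i j hts
    have h2 := (hH.hasDerivAt_rowTransform one_le_two hts.le hκ i j hts).mul
      (hρc j s hts.le)
    have h3 : rowTransform (fun i j p => H i j p * ρ j p.2) s i (fun l q => k 0 i q l) j
        = fun y => rowTransform H s i (fun l q => k 0 i q l) j y * ρ j y :=
      funext fun y => rowTransform_mul_weight ρ i _ j y
    rw [h3] at h1
    have h4 := h1.unique h2
    have h5 := hsolw i j s le_rfl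
    rw [rowTransform_mul_weight] at h5
    have h6 := mul_right_cancel₀ (hr_ne j _ (hJt j s hts.le)) h5
    rw [h4, h6, hk0]
    ring
  have hsum := hHr.rowTransform_dSnd_add hts hκ hκ'
    (fun l q hq => (hρc l q (hts.le.trans hq)).continuousAt.continuousWithinAt) hskew
    (fun l q hq => hsolw i l q hq) (fun l q hq => hsolw j l q hq)
  rw [hTw hκ, hTw hκ', sum_eq_add_add_sum_ne _ hij] at hsum
  simp only [hk0] at hsum
  have hrd : ∀ i, HasDerivAt (fun x => r i (x - s)) (deriv (r i) (u i - s)) (u i) := fun i => by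
    simpa using (hr i _ (hJt i s hts.le)).hasDerivAt.comp_sub_const (u i) s
  simp only
  rw [pd_coord_mul (hβ i j).differentiableAt i (hrd i),
    pd_coord_mul (hβ j i).differentiableAt j (hrd j), hpd i j i hij, hpd j i j hij.symm,
    if_pos rfl, if_pos rfl]
  simp only [rotationCoeff]
  have hfil : ∑ l with l ≠ i ∧ l ≠ j, r l (u l - s) ^ 2 * K i l s s u * K j l s s u
      = ∑ l with l ≠ i ∧ l ≠ j, K i l s s u * ρ l s * (K j l s s u * ρ l s) :=
    Finset.sum_congr rfl fun l _ => by simp only [hρ]; ring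
  rw [hfil]
  simp only [hT, hρ] at hsum ⊢
  linear_combination -hsum

end Lame

/-- Since f(y) - f(x) = (r(y) - r(x))(r(y) + r(x)), the slope of r is that of f divided by r(y) +
r(x), which tends to 2r(x) ≠ 0 by continuity. -/
theorem hasDerivAt_of_sq_eq {J : Set ℝ} (hJ : IsOpen J) {f r : ℝ → ℂ} (hr : ContinuousOn r J)
    (hsq : ∀ x ∈ J, r x ^ 2 = f x) {x : ℝ} (hx : x ∈ J) (hne : r x ≠ 0) {f' : ℂ}
    (hf : HasDerivAt f f' x) : HasDerivAt r (f' / (2 * r x)) x := by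
  have hrx : ContinuousAt r x := hr.continuousAt (hJ.mem_nhds hx)
  have hsum : Tendsto (fun y => r y + r x) (𝓝 x) (𝓝 (2 * r x)) := by
    rw [two_mul]
    exact hrx.tendsto.add tendsto_const_nhds
  have h2 : 2 * r x ≠ 0 := mul_ne_zero two_ne_zero hne
  rw [hasDerivAt_iff_tendsto_slope] at hf ⊢
  refine (hf.div (hsum.mono_left nhdsWithin_le_nhds) h2).congr' ?_
  filter_upwards [nhdsWithin_le_nhds (hJ.mem_nhds hx),
    nhdsWithin_le_nhds (hsum.eventually_ne h2)] with y hy hy'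
  rw [Pi.div_apply, div_eq_iff hy', slope, slope, vsub_eq_sub, vsub_eq_sub, smul_mul_assoc,
    ← hsq y hy, ← hsq x hx]
  congr 1
  ring

/-! ### Partial derivatives in the plane and equality of mixed ones -/

section PlaneDerivatives

/-- `∂g/∂x` for a function on the plane. -/
def partialFst (g : ℝ × ℝ → ℂ) (p : ℝ × ℝ) : ℂ := fderiv ℝ g p (1, 0)

/-- `∂g/∂y` for a function on the plane. -/
def partialSnd (g : ℝ × ℝ → ℂ) (p : ℝ × ℝ) : ℂ := fderiv ℝ g p (0, 1)

variable {g : ℝ × ℝ → ℂ} {x y : ℝ}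

theorem hasDerivAt_prodMk_left (x y : ℝ) :
    HasDerivAt (fun x : ℝ => (x, y)) ((1 : ℝ), (0 : ℝ)) x :=
  (hasDerivAt_id x).prodMk (hasDerivAt_const x y)

theorem hasDerivAt_prodMk_right (x y : ℝ) :
    HasDerivAt (fun y : ℝ => (x, y)) ((0 : ℝ), (1 : ℝ)) y :=
  (hasDerivAt_const y x).prodMk (hasDerivAt_id y)

theorem hasDerivAt_partialFst (hg : DifferentiableAt ℝ g (x, y)) :
    HasDerivAt (fun x => g (x, y)) (partialFst g (x, y)) x :=
  hg.hasFDerivAt.comp_hasDerivAt x (hasDerivAt_prodMk_left x y)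

theorem hasDerivAt_partialSnd (hg : DifferentiableAt ℝ g (x, y)) :
    HasDerivAt (fun y => g (x, y)) (partialSnd g (x, y)) y :=
  hg.hasFDerivAt.comp_hasDerivAt y (hasDerivAt_prodMk_right x y)

theorem hasFDerivAt_fderiv_apply (hg : ContDiffAt ℝ 2 g (x, y)) (e : ℝ × ℝ) :
    HasFDerivAt (fun p => fderiv ℝ g p e)
      ((ContinuousLinearMap.apply ℝ ℂ e).comp (fderiv ℝ (fderiv ℝ g) (x, y))) (x, y) := by
  have h1 : DifferentiableAt ℝ (fderiv ℝ g) (x, y) :=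
    (hg.fderiv_right (m := 1) (by norm_num)).differentiableAt one_ne_zero
  exact (ContinuousLinearMap.apply ℝ ℂ e).hasFDerivAt.comp (x, y) h1.hasFDerivAt

theorem hasDerivAt_partialSnd_partialFst (hg : ContDiffAt ℝ 2 g (x, y)) :
    HasDerivAt (fun y => partialFst g (x, y)) (partialSnd (partialFst g) (x, y)) y :=
  hasDerivAt_partialSnd (hasFDerivAt_fderiv_apply hg (1, 0)).differentiableAt

theorem hasDerivAt_partialFst_partialSnd (hg : ContDiffAt ℝ 2 g (x, y)) :
    HasDerivAt (fun x => partialSnd g (x, y)) (partialSnd (partialFst g) (x, y)) x := by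
  have h1 := hasDerivAt_partialFst (hasFDerivAt_fderiv_apply hg (0, 1)).differentiableAt
  have hsym : partialFst (partialSnd g) (x, y) = partialSnd (partialFst g) (x, y) := by
    have e1 := (hasFDerivAt_fderiv_apply hg (0, 1)).fderiv
    have e2 := (hasFDerivAt_fderiv_apply hg (1, 0)).fderiv
    have h2 := hg.isSymmSndFDerivAt (by simp) (1, 0) (0, 1)
    unfold partialFst partialSnd
    rw [e1, e2]
    simpa using h2
  rw [← hsym]
  exact h1

end PlaneDerivatives

/-! ### Generating functions and their linear equations -/

section Generating

variable {N : ℕ} {J : Fin N → Set ℝ} {f r : Fin N → ℝ → ℂ} {F Φ : Fin N → Fin N → ℝ → ℝ → ℂ}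

/-- The generating function as a function on the plane. -/
def planeFun (Φ : Fin N → Fin N → ℝ → ℝ → ℂ) (i j : Fin N) (p : ℝ × ℝ) : ℂ := Φ i j p.1 p.2

namespace Generates

theorem contDiffAt (hJ : ∀ i, IsOpen (J i)) (h : Generates J Φ F) {i j : Fin N} (hij : i ≤ j)
    {x y : ℝ} (hx : -x ∈ J i) (hy : -y ∈ J j) : ContDiffAt ℝ 2 (planeFun Φ i j) (x, y) :=
  (h.smooth i j hij).contDiffAt ((isOpen_quadrant (hJ i) (hJ j)).mem_nhds ⟨hx, hy⟩)

theorem eq_partialFst (hJ : ∀ i, IsOpen (J i)) (h : Generates J Φ F) {i j : Fin N} (hij : i ≤ j)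
    {x y : ℝ} (hx : -x ∈ J i) (hy : -y ∈ J j) :
    F i j x y = partialFst (planeFun Φ i j) (x, y) := by
  have h1 := h.upper i j hij 0 x y (by simpa using hx) (by simpa using hy)
  simp only [Pi.zero_apply, sub_zero] at h1
  rw [h1]
  exact (hasDerivAt_partialFst ((h.contDiffAt hJ hij hx hy).differentiableAt two_ne_zero)).deriv

/-- For i = j this comes from skew symmetry of Φ_ii, so the diagonal case needs no separate
treatment afterwards. -/
theorem eq_neg_partialSnd (hJ : ∀ i, IsOpen (J i)) (h : Generates J Φ F) {i j : Fin N}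
    (hij : i ≤ j) {x y : ℝ} (hx : -x ∈ J i) (hy : -y ∈ J j) :
    F j i y x = -partialSnd (planeFun Φ i j) (x, y) := by
  have hd := hasDerivAt_partialSnd
    ((h.contDiffAt hJ hij hx hy).differentiableAt two_ne_zero)
  rcases hij.lt_or_eq with hlt | rfl
  · have h1 := h.lower i j hlt 0 y x (by simpa using hy) (by simpa using hx)
    simp only [Pi.zero_apply, sub_zero] at h1
    rw [h1, ← hd.deriv]
    rfl
  · rw [h.eq_partialFst hJ le_rfl hy hx]
    have h2 := hasDerivAt_partialFst
      ((h.contDiffAt hJ le_rfl hy hx).differentiableAt two_ne_zero)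
    refine h2.unique (hd.neg.congr_of_eventuallyEq ?_)
    have hev : ∀ᶠ t in 𝓝 y, -t ∈ J i := continuousAt_neg.eventually ((hJ i).mem_nhds hy)
    exact hev.mono fun t ht => h.skew i t x ht hx

end Generates

/-- The two cases `i ≤ j` and `j ≤ i` of the Zakharov relation are equivalent. -/
theorem zakharovRelation_iff {𝓕 : Fin N → Fin N → ℝ → ℝ → (Fin N → ℝ) → ℂ} :
    ZakharovRelation J 𝓕 ↔ ∀ (i j : Fin N), i ≤ j → ∀ (u : Fin N → ℝ) (s s' : ℝ),
      u i - s ∈ J i → u j - s' ∈ J j →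
      deriv (fun t : ℝ => 𝓕 i j s t u) s' + deriv (fun t : ℝ => 𝓕 j i s' t u) s = 0 := by
  refine ⟨fun h i j _ => h i j, fun h i j u s s' hs hs' => ?_⟩
  rcases le_total i j with hij | hij
  · exact h i j hij u s s' hs hs'
  · rw [add_comm]
    exact h j i hij u s' s hs' hs

theorem eventually_sub_mem {J : Set ℝ} (hJ : IsOpen J) {a b : ℝ} (h : a - b ∈ J) :
    ∀ᶠ t in 𝓝 b, a - t ∈ J := by
  have hc : ContinuousAt (fun t => a - t) b := by fun_prop
  exact hc.eventually (hJ.mem_nhds h)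

theorem eventually_neg_sub_mem {J : Set ℝ} (hJ : IsOpen J) {a b : ℝ} (h : a - b ∈ J) :
    ∀ᶠ t in 𝓝 b, -(t - a) ∈ J := by
  simpa using eventually_sub_mem hJ h

/-- A weighted form of the sum of derivatives in the Zakharov relation, for kernels generated
by `Φ`. -/
theorem Generates.hasDerivAt_weighted (hJ : ∀ i, IsOpen (J i)) (h : Generates J Φ F)
    {i j : Fin N} (hij : i ≤ j) {u : Fin N → ℝ} {s s' : ℝ} (hs : u i - s ∈ J i)
    (hs' : u j - s' ∈ J j) {a b : ℝ → ℂ} {a' b' : ℂ} (ha : HasDerivAt a a' s)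
    (hb : HasDerivAt b b' s') :
    HasDerivAt (fun t => b t * F i j (s - u i) (t - u j))
      (b' * partialFst (planeFun Φ i j) (s - u i, s' - u j)
        + b s' * partialSnd (partialFst (planeFun Φ i j)) (s - u i, s' - u j)) s' ∧
    HasDerivAt (fun t => a t * F j i (s' - u j) (t - u i))
      (-(a' * partialSnd (planeFun Φ i j) (s - u i, s' - u j)
        + a s * partialSnd (partialFst (planeFun Φ i j)) (s - u i, s' - u j))) s := by
  have hs1 : -(s - u i) ∈ J i := by simpa using hs
  have hs2 : -(s' - u j) ∈ J j := by simpa using hs'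
  have hC := h.contDiffAt hJ hij hs1 hs2
  constructor
  · have h1 := (hasDerivAt_partialSnd_partialFst hC).comp_sub_const s' (u j)
    refine (hb.mul h1).congr_of_eventuallyEq ?_
    filter_upwards [eventually_neg_sub_mem (hJ j) hs'] with t ht
    rw [h.eq_partialFst hJ hij hs1 ht]
    rfl
  · have h1 := (hasDerivAt_partialFst_partialSnd hC).comp_sub_const s (u i)
    refine (ha.mul h1).neg.congr_of_eventuallyEq ?_
    filter_upwards [eventually_neg_sub_mem (hJ i) hs] with t ht
    rw [h.eq_neg_partialSnd hJ hij ht hs2, mul_neg]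
    rfl

theorem Generates.zakharovRelation_dressing (hJ : ∀ i, IsOpen (J i)) (h : Generates J Φ F) :
    ZakharovRelation J (dressing F) := by
  refine zakharovRelation_iff.2 fun i j hij u s s' hs hs' => ?_
  obtain ⟨h1, h2⟩ := h.hasDerivAt_weighted hJ hij hs hs' (hasDerivAt_const s (1 : ℂ))
    (hasDerivAt_const s' (1 : ℂ))
  simp only [one_mul] at h1 h2
  simp only [dressing]
  rw [h1.deriv, h2.deriv]
  ring

/-- The common form of the linear equations for the generating functions, `i ≤ j`. -/
def LinearEq (f : Fin N → ℝ → ℂ) (Φ : Fin N → Fin N → ℝ → ℝ → ℂ) (i j : Fin N)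
    (u : Fin N → ℝ) (s s' : ℝ) : Prop :=
  2 * partialSnd (partialFst (planeFun Φ i j)) (s - u i, s' - u j)
      * (f i (u i - s) - f j (u j - s'))
    + partialFst (planeFun Φ i j) (s - u i, s' - u j) * deriv (f j) (u j - s')
    - partialSnd (planeFun Φ i j) (s - u i, s' - u j) * deriv (f i) (u i - s) = 0

/-- With b = r_j/r_i and a = r_i/r_j, the relation reads b' ∂₁Φ - a' ∂₂Φ + (b - a) ∂₁∂₂Φ = 0, where
b' is taken in s' and a' in s. -/
theorem Generates.zakharovRelation_rescaledDressing_iff (hJ : ∀ i, IsOpen (J i))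
    (hr : ∀ i, ∀ x ∈ J i, HasDerivAt (r i) (deriv (f i) x / (2 * r i x)) x)
    (hr_ne : ∀ i, ∀ x ∈ J i, r i x ≠ 0) (hr_sq : ∀ i, ∀ x ∈ J i, r i x ^ 2 = f i x)
    (h : Generates J Φ F) :
    ZakharovRelation J (rescaledDressing r F) ↔ ∀ i j, i ≤ j → ∀ (u : Fin N → ℝ) (s s' : ℝ),
      u i - s ∈ J i → u j - s' ∈ J j → LinearEq f Φ i j u s s' := by
  have hρ : ∀ i (a q : ℝ), a - q ∈ J i → HasDerivAt (fun q => r i (a - q))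
      (-(deriv (f i) (a - q) / (2 * r i (a - q)))) q := fun i a q hq => by
    have h1 : HasDerivAt (fun q => a - q) (-1) q := by
      simpa using (hasDerivAt_id q).const_sub a
    have h2 := (hr i _ hq).scomp q h1
    rw [neg_one_smul] at h2
    exact h2
  refine zakharovRelation_iff.trans (forall_congr' fun i => forall_congr' fun j =>
    forall_congr' fun hij => forall_congr' fun u => forall_congr' fun s => forall_congr' fun s' =>
    forall_congr' fun hs => forall_congr' fun hs' => ?_)
  have n1 := hr_ne i _ hs
  have n2 := hr_ne j _ hs'
  obtain ⟨h1, h2⟩ := h.hasDerivAt_weighted hJ hij hs hs'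
    ((hρ i (u i) s hs).div_const (r j (u j - s'))) ((hρ j (u j) s' hs').div_const (r i (u i - s)))
  simp only [rescaledDressing]
  rw [h1.deriv, h2.deriv, LinearEq, ← hr_sq i _ hs, ← hr_sq j _ hs']
  -- The nonzero factor -2 r_i r_j clears the denominators, including the 2r in the derivative of
  -- the square root.
  rw [← mul_right_inj' (mul_ne_zero (mul_ne_zero (neg_ne_zero.2 (two_ne_zero (α := ℂ))) n1) n2),
    mul_zero]
  refine Eq.congr_left ?_
  field_simp
  ring

theorem Generates.linearOffDiag_iff (hJ : ∀ i, IsOpen (J i)) (h : Generates J Φ F) :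
    LinearOffDiag J f Φ ↔ ∀ i j, i < j → ∀ (u : Fin N → ℝ) (s s' : ℝ),
      u i - s ∈ J i → u j - s' ∈ J j → LinearEq f Φ i j u s s' := by
  refine forall_congr' fun i => forall_congr' fun j =>
    forall_congr' fun hij => forall_congr' fun u => forall_congr' fun s => forall_congr' fun s' =>
    forall_congr' fun hs => forall_congr' fun hs' => ?_
  have hne : i ≠ j := hij.ne
  have hmem : ∀ {x a : ℝ} {A : Set ℝ}, a - x ∈ A → -(x - a) ∈ A := fun h => by simpa using h
  have hi : ∀ w : Fin N → ℝ, w i - s ∈ J i → w j - s' ∈ J j →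
      pd i (fun w => Φ i j (s - w i) (s' - w j)) w
        = -partialFst (planeFun Φ i j) (s - w i, s' - w j) := fun w hw hw' => by
    have h1 := (hasDerivAt_partialFst
      ((h.contDiffAt hJ hij.le (hmem hw) (hmem hw')).differentiableAt two_ne_zero)).comp_const_sub
      s (w i)
    rw [← h1.deriv, pd]
    simp [hne.symm, planeFun]
  have hj : ∀ w : Fin N → ℝ, w i - s ∈ J i → w j - s' ∈ J j →
      pd j (fun w => Φ i j (s - w i) (s' - w j)) w
        = -partialSnd (planeFun Φ i j) (s - w i, s' - w j) := fun w hw hw' => by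
    have h1 := (hasDerivAt_partialSnd
      ((h.contDiffAt hJ hij.le (hmem hw) (hmem hw')).differentiableAt two_ne_zero)).comp_const_sub
      s' (w j)
    rw [← h1.deriv, pd]
    simp [hne, planeFun]
  -- The two sign changes from the arguments s - u^i and s' - u^j cancel in the mixed derivative.
  have hij2 : pd i (pd j (fun w => Φ i j (s - w i) (s' - w j))) u
      = partialSnd (partialFst (planeFun Φ i j)) (s - u i, s' - u j) := by
    have h1 := ((hasDerivAt_partialFst_partialSnd
      (h.contDiffAt hJ hij.le (hmem hs) (hmem hs'))).comp_const_sub s (u i)).neg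
    rw [neg_neg] at h1
    refine Eq.trans (Filter.EventuallyEq.deriv_eq ?_) h1.deriv
    have hc : ContinuousAt (fun t => t - s) (u i) := by fun_prop
    filter_upwards [hc.eventually ((hJ i).mem_nhds hs)] with t ht
    have ht' : t - s ∈ J i := ht
    rw [hj _ (by simpa using ht') (by simpa [hne.symm] using hs')]
    simp [hne.symm]
  rw [hij2, hi u hs hs', hj u hs hs', deriv_comp_sub_const, deriv_comp_sub_const, LinearEq]
  refine Eq.congr_left ?_
  ring

theorem Generates.linearDiag_iff (hJ : ∀ i, IsOpen (J i)) (h : Generates J Φ F) :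
    LinearDiag J f Φ ↔ ∀ i, ∀ (u : Fin N → ℝ) (s s' : ℝ),
      u i - s ∈ J i → u i - s' ∈ J i → LinearEq f Φ i i u s s' := by
  refine forall_congr' fun i => forall_congr' fun u => forall_congr' fun s =>
    forall_congr' fun s' => forall_congr' fun hs => forall_congr' fun hs' => ?_
  have hmem : ∀ {x a : ℝ} {A : Set ℝ}, a - x ∈ A → -(x - a) ∈ A := fun h => by simpa using h
  have h1 : deriv (fun x => Φ i i (x - u i) (s' - u i)) s
      = partialFst (planeFun Φ i i) (s - u i, s' - u i) :=
    ((hasDerivAt_partialFst ((h.contDiffAt hJ le_rfl (hmem hs) (hmem hs')).differentiableAt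
      two_ne_zero)).comp_sub_const s (u i)).deriv
  have h2 : ∀ x, -(x - u i) ∈ J i → deriv (fun y => Φ i i (x - u i) (y - u i)) s'
      = partialSnd (planeFun Φ i i) (x - u i, s' - u i) := fun x hx =>
    ((hasDerivAt_partialSnd ((h.contDiffAt hJ le_rfl hx (hmem hs')).differentiableAt
      two_ne_zero)).comp_sub_const s' (u i)).deriv
  have h3 : deriv (fun x => deriv (fun y => Φ i i (x - u i) (y - u i)) s') s
      = partialSnd (partialFst (planeFun Φ i i)) (s - u i, s' - u i) := by
    refine Eq.trans (Filter.EventuallyEq.deriv_eq ?_) ((hasDerivAt_partialFst_partialSnd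
      (h.contDiffAt hJ le_rfl (hmem hs) (hmem hs'))).comp_sub_const s (u i)).deriv
    filter_upwards [eventually_neg_sub_mem (hJ i) hs] with x hx
    exact h2 x hx
  rw [h1, h2 s (hmem hs), h3, deriv_comp_const_sub, deriv_comp_const_sub, LinearEq]
  refine Eq.congr_left ?_
  ring

end Generating

theorem Decays.mono {n n' : ℕ} (hn : n' ≤ n) {A B : Set ℝ} {H : ℝ × ℝ → ℂ}
    (h : Decays n A B H) : Decays n' A B H := by
  refine ⟨h.1.of_le (by exact_mod_cast hn), fun x₀ y₀ hx hy => ?_⟩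
  obtain ⟨m, b, hm, hmi, hb, hbi, hbd⟩ := h.2 x₀ y₀ hx hy
  exact ⟨m, b, hm, hmi, hb, hbi, fun k hk => hbd k (hk.trans hn)⟩

end

theorem mainTheorem10 (N : ℕ) (J : Fin N → Set ℝ)
    (hJ_open : ∀ i, IsOpen (J i)) (hJ_lower : ∀ i, IsLowerSet (J i))
    (f r : Fin N → ℝ → ℂ)
    (hf : ∀ i, ContDiffOn ℝ 1 (f i) (J i)) (hf_ne : ∀ i, ∀ x ∈ J i, f i x ≠ 0)
    (hr : ∀ i, ContinuousOn (r i) (J i)) (hr_sq : ∀ i, ∀ x ∈ J i, r i x ^ 2 = f i x) :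
    (∀ F : Fin N → Fin N → ℝ → ℝ → ℂ,
      (∀ i j, Decays 2 (J i) (J j) (fun p => F i j p.1 p.2)) →
      (∀ i j, Decays 1 (J i) (J j) (fun p => F i j p.1 p.2 * r j (-p.2))) →
      ZakharovRelation J (dressing F) →
      ZakharovRelation J (rescaledDressing r F) →
      ∀ (W : Set (ℝ × (Fin N → ℝ))) (K : Fin N → Fin N → ℝ → ℝ → (Fin N → ℝ) → ℂ),
        IsOpen W →
        (∀ s u, (s, u) ∈ W → ∀ i, u i - s ∈ J i) →
        (∀ s u, (s, u) ∈ W →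
          IsUniqueGLMSolution (fun i j q q' => dressing F i j q q' u) s
            (fun i j s' => K i j s s' u)) →
        ∀ s u, (s, u) ∈ W →
          (∀ i j, DifferentiableAt ℝ (rotationCoeff K s i j) u) ∧
          Lame1 (rotationCoeff K s) u ∧
          Lame2 (rotationCoeff K s) u ∧
          Lame3 (fun i x => f i (x - s)) (fun i x => r i (x - s)) (rotationCoeff K s) u) ∧
    (∀ F Φ : Fin N → Fin N → ℝ → ℝ → ℂ, Generates J Φ F →
      ZakharovRelation J (dressing F) ∧
      (ZakharovRelation J (rescaledDressing r F) ↔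
        LinearOffDiag J f Φ ∧ LinearDiag J f Φ)) := by
  have hr_ne : ∀ i, ∀ x ∈ J i, r i x ≠ 0 := fun i x hx h0 =>
    hf_ne i x hx (by rw [← hr_sq i x hx, h0]; simp)
  have hr_deriv : ∀ i, ∀ x ∈ J i, HasDerivAt (r i) (deriv (f i) x / (2 * r i x)) x :=
    fun i x hx => hasDerivAt_of_sq_eq (hJ_open i) (hr i) (hr_sq i) hx (hr_ne i x hx)
      (((hf i).contDiffAt ((hJ_open i).mem_nhds hx)).differentiableAt one_ne_zero).hasDerivAt
  refine ⟨fun F hF hFr hZ hZr W K hW hWJ hK s u hsu => ?_, fun F Φ h => ?_⟩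
  · obtain ⟨hd, h1, h3⟩ := dressing_lame hJ_open hJ_lower
      (fun i x hx => (hr_deriv i x hx).differentiableAt) hr_ne hF hFr hZr hW hWJ hK hsu
    -- With weight 1 the rescaled kernel is the original one, and the third relation becomes the
    -- second.
    obtain ⟨-, -, h2⟩ := dressing_lame (r := fun _ _ => 1) hJ_open hJ_lower
      (fun _ _ _ => differentiableAt_const _) (fun _ _ _ => one_ne_zero) hF
      (fun i j => by simpa using (hF i j).mono one_le_two)
      (fun i j u s s' hs hs' => by
        simpa [rescaledDressing, dressing] using hZ i j u s s' hs hs') hW hWJ hK hsu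
    refine ⟨hd, h1, fun i j hij => by simpa using h2 i j hij, fun i j hij => ?_⟩
    rw [← h3 i j hij]
    congr 1
    exact Finset.sum_congr rfl fun l _ => by simp only [hr_sq l _ (hWJ s u hsu l)]
  · refine ⟨h.zakharovRelation_dressing hJ_open, ?_⟩
    rw [h.zakharovRelation_rescaledDressing_iff hJ_open hr_deriv hr_ne hr_sq,
      h.linearOffDiag_iff hJ_open, h.linearDiag_iff hJ_open]
    refine ⟨fun hl => ⟨fun i j hij => hl i j hij.le, fun i => hl i i le_rfl⟩,
      fun ⟨ho, hd⟩ i j hij => ?_⟩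
    rcases hij.lt_or_eq with hlt | rfl
    · exact ho i j hlt
    · exact hd i
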